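/- Let $S_{\mathbb Z}$ be the group of permutations of $\mathbb Z$ fixing all but finitely many points, with length $\ell(w)=|\mathrm{Inv}(w)|$, where $\mathrm{Inv}(w)=\{(i,j): i<j,\ w(i)>w(j)\}$, and with simple transpositions $s_i=(i,i+1)$, $i\in\mathbb Z$. Let $\Theta:\mathbb Z\to\mathbb Z$, $\Theta(i)=i-(-1)^i$, and let $\mathcal F_{\mathbb Z}=\{w^{-1}\Theta w: w\in S_{\mathbb Z}\}$. For $z\in\mathcal F_{\mathbb Z}$ put $\mathrm{Cyc}_{\mathbb Z}(z)=\{(i,j): i\le j=z(i)\}$ and $\hat\ell(z)=\frac12|\mathrm{Inv}(z)\setminus\mathrm{Cyc}_{\mathbb Z}(z)|$. Let $<$ be the weakest partial order on $\mathcal F_{\mathbb Z}$ with $z<tzt$ whenever $t$ is a transposition and $\hat\ell(z)<\hat\ell(tzt)$, and write $y\lessdot z$ if $\{w\in\mathcal F_{\mathbb Z}: y\le w<z\}=\{y\}$. For $r\in\mathbb Z$ let $$\hat\Psi^+(y,r)=\{z: y\lessdot z=(r,j)y(r,j)\text{ for some } j>r\},\qquad \hat\Psi^-(y,r)=\{z: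 y\lessdot z=(i,r)y(i,r)\text{ for some } i<r\}.$$ Let $\hat{\mathcal R}_{FPF}(z)$ be the set of all reduced words $(s_{a_1},\dots,s_{a_k})$ of the elements $w\in S_{\mathbb Z}$ of minimal length with $z=w^{-1}\Theta w$. Let $y\in\mathcal F_{\mathbb Z}$. A pair $(\mathbf a,i)$ of a word $\mathbf a=(s_{a_1},\dots,s_{a_k})$ and an index $1\le i\le k$ is a $y$-marked word if deleting the $i$-th letter of $\mathbf a$ gives an element of $\hat{\mathcal R}_{FPF}(y)$. It is reduced if $\mathbf a\in\hat{\mathcal R}_{FPF}(z)$ for some $z\in\mathcal F_{\mathbb Z}$, and semi-reduced if $u^{-1}\Theta u=v^{-1}\Theta v$ for $u=s_{a_1}\cdots s_{a_k}$ and $v=s_{a_1}\cdots\widehat{s_{a_i}}\cdots s_{a_k}$. For a $y$-marked word $(\mathbf a,i)$ let $\mathbf b$ be obtained from $\mathbf a$ by replacing its $i$-th letter $s_{a_i}$ by $s_{a_i-1}$, and put $(\mathbf a,i)\Downarrow=(\mathbf b,j)$, where $j=i$ if $(\mathbf b,i)$ is reduced or semi-reduced, and otherwise $j$ is the index different from $i$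 such that $(\mathbf b,j)$ is a $y$-marked word. Let $\hat{\mathcal B}^{FPF}(\mathbf a,i)=(\mathbf a,i)\Downarrow^N$ with $N>0$ minimal such that the result is reduced. If $y\lessdot z$ and $\mathbf a\in\hat{\mathcal R}_{FPF}(z)$, let $\hat{\mathcal B}^{FPF}_y(\mathbf a)$ be the word of $\hat{\mathcal B}^{FPF}(\mathbf a,i)$, where $i$ is the index such that $(\mathbf a,i)$ is a $y$-marked word. **Theorem.** Let $y\in\mathcal F_{\mathbb Z}$ and $(p,q)\in\mathrm{Cyc}_{\mathbb Z}(y)$. These operations are well defined: a $y$-marked word $(\mathbf a,i)$ that is neither reduced nor semi-reduced has exactly one index $j\ne i$ such that $(\mathbf a,j)$ is a $y$-marked word; for each $y$-marked word $(\mathbf a,i)$ some $(\mathbf a,i)\Downarrow^N$ with $N>0$ is reduced; and if $y\lessdot z$ and $\mathbf a\in\hat{\mathcal R}_{FPF}(z)$, then exactly one index $i$ makes $(\mathbf a,i)$ a $y$-marked word. The map $\hat{\mathcal B}^{FPF}_y$ restricts to a bijection $$\bigcup_{z\in\hat\Psi^+(y,q)}\hat{\mathcal R}_{FPF}(z)\;\to\;\bigcup_{z\in\hat\Psi^-(y,p)}\hat{\mathcal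 R}_{FPF}(z).$$ Moreover the sets $\hat\Psi^+(y,q)$ and $\hat\Psi^-(y,p)$, and $\hat{\mathcal R}_{FPF}(z)$ for each $z$ in them, are finite, and $$\sum_{z\in\hat\Psi^+(y,q)}|\hat{\mathcal R}_{FPF}(z)|=\sum_{z\in\hat\Psi^-(y,p)}|\hat{\mathcal R}_{FPF}(z)|.$$ -/

import Mathlib

namespace FPFLittle

/-- The permutations of `ℤ` are composed as functions, `(u * v) i = u (v i)`.
`SZ` is the set (a group) of permutations of `ℤ` fixing all but finitely many integers. -/
def SZ : Set (Equiv.Perm ℤ) := {w | {i : ℤ | w i ≠ i}.Finite}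

/-- The permutation `Θ : i ↦ i - (-1)^i`, with cycles `(2k-1, 2k)` for `k ∈ ℤ`. -/
def Theta : Equiv.Perm ℤ where
  toFun i := if Even i then i - 1 else i + 1
  invFun i := if Even i then i - 1 else i + 1
  left_inv i := by
    by_cases h : Even i
    · simp [h]
    · simp [h]
  right_inv i := by
    by_cases h : Even i
    · simp [h]
    · simp [h]

/-- `FZ` is the conjugacy class of `Θ` under the group `SZ`. -/
def FZ : Set (Equiv.Perm ℤ) := {z | ∃ w ∈ SZ, z = w⁻¹ * Theta * w}

/-- The cycles `(i, j)` of an involution `y`, written with `i ≤ j`. -/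
def Cyc (y : Equiv.Perm ℤ) : Set (ℤ × ℤ) := {c | c.1 ≤ c.2 ∧ y c.1 = c.2}

/-- The inversion set. -/
def Inv (w : Equiv.Perm ℤ) : Set (ℤ × ℤ) := {c | c.1 < c.2 ∧ w c.2 < w c.1}

/-- The Coxeter length of `w ∈ SZ`, that is, its number of inversions. -/
noncomputable def len (w : Equiv.Perm ℤ) : ℕ := (Inv w).ncard

/-- The rank function `½ |Inv(z) \ Cyc(z)|` for `z ∈ FZ`. -/
noncomputable def lenFPF (z : Equiv.Perm ℤ) : ℕ := (Inv z \ Cyc z).ncard / 2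

/-- The simple transposition `s_i = (i, i+1)`. -/
def simple (i : ℤ) : Equiv.Perm ℤ := Equiv.swap i (i + 1)

/-- A sequence of simple transpositions `(s_{a_1}, …, s_{a_k})` is encoded by its list of
indices `a = [a_1, …, a_k]`; this is its product `s_{a_1} ⋯ s_{a_k}`. -/
def wordProd (a : List ℤ) : Equiv.Perm ℤ := (a.map simple).prod

/-- The reduced words of `w`. -/
def RedWords (w : Equiv.Perm ℤ) : Set (List ℤ) := {a | wordProd a = w ∧ a.length = len w}

/-- The elements `w ∈ SZ` of minimal length such that `z = w⁻¹ Θ w`. -/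
def AFPF (z : Equiv.Perm ℤ) : Set (Equiv.Perm ℤ) :=
  {w | w ∈ SZ ∧ z = w⁻¹ * Theta * w ∧
    ∀ v ∈ SZ, z = v⁻¹ * Theta * v → len w ≤ len v}

/-- The FPF-involution words of `z`. -/
def RFPF (z : Equiv.Perm ℤ) : Set (List ℤ) := ⋃ w ∈ AFPF z, RedWords w

/-- The generating relations `z < t z t` of the Bruhat order on `FZ`, where `t` is a transposition
and the rank increases. -/
def BruhatStep (z z' : Equiv.Perm ℤ) : Prop :=
  z ∈ FZ ∧ ∃ t : Equiv.Perm ℤ, t.IsSwap ∧ z' = t * z * t ∧ lenFPF z < lenFPF z'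

/-- The strict Bruhat order on `FZ`. -/
def BruhatLT : Equiv.Perm ℤ → Equiv.Perm ℤ → Prop := Relation.TransGen BruhatStep

/-- The non-strict (reflexive) Bruhat order on `FZ`. -/
def BruhatLE : Equiv.Perm ℤ → Equiv.Perm ℤ → Prop := Relation.ReflTransGen BruhatStep

/-- The covering relation of the Bruhat order on `FZ`. -/
def Covers (y z : Equiv.Perm ℤ) : Prop :=
  y ∈ FZ ∧ z ∈ FZ ∧ {w | w ∈ FZ ∧ BruhatLE y w ∧ BruhatLT w z} = {y}

/-- The covers `z = (r, j) y (r, j)` of `y` with `j > r`. -/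
def PsiPlus (y : Equiv.Perm ℤ) (r : ℤ) : Set (Equiv.Perm ℤ) :=
  {z | Covers y z ∧ ∃ j : ℤ, r < j ∧ z = Equiv.swap r j * y * Equiv.swap r j}

/-- The covers `z = (i, r) y (i, r)` of `y` with `i < r`. -/
def PsiMinus (y : Equiv.Perm ℤ) (r : ℤ) : Set (Equiv.Perm ℤ) :=
  {z | Covers y z ∧ ∃ i : ℤ, i < r ∧ z = Equiv.swap i r * y * Equiv.swap i r}

/-- The pair `m = (a, i)` is a `y`-marked FPF-involution word: `i` is a position in the word `a`
(positions are counted from `0`), and deleting the letter there gives an FPF-involution word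
of `y`. -/
def Marked (y : Equiv.Perm ℤ) (m : List ℤ × ℕ) : Prop :=
  m.2 < m.1.length ∧ m.1.eraseIdx m.2 ∈ RFPF y

/-- The word `a` is an FPF-involution word of some `z ∈ FZ`. -/
def Reduced (a : List ℤ) : Prop := ∃ z ∈ FZ, a ∈ RFPF z

/-- The marked word `(a, i)` is semi-reduced: `u⁻¹ Θ u = v⁻¹ Θ v`, with `u` the product of `a` and
`v` the product of `a` without its `i`-th letter. -/
def SemiReduced (m : List ℤ × ℕ) : Prop :=
  (wordProd m.1)⁻¹ * Theta * wordProd m.1 =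
    (wordProd (m.1.eraseIdx m.2))⁻¹ * Theta * wordProd (m.1.eraseIdx m.2)

/-- The word formed by decrementing the letter in the marked position. -/
def decr (m : List ℤ × ℕ) : List ℤ := m.1.modify m.2 (fun x => x - 1)

open Classical in
/-- The operator `⇓` on `y`-marked FPF-involution words. In the second case the set consists of a
single index. -/
noncomputable def down (y : Equiv.Perm ℤ) (m : List ℤ × ℕ) : List ℤ × ℕ :=
  if Reduced (decr m) ∨ SemiReduced (decr m, m.2) then (decr m, m.2)
  else (decr m, sInf {j : ℕ | j ≠ m.2 ∧ Marked y (decr m, j)})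

/-- The FPF-involution Little bump: apply `⇓` the least positive number of times after which the
marked word is reduced. -/
noncomputable def bump (y : Equiv.Perm ℤ) (m : List ℤ × ℕ) : List ℤ × ℕ :=
  (down y)^[sInf {N : ℕ | 0 < N ∧ Reduced ((down y)^[N] m).1}] m

/-- The FPF-involution Little map: mark `a` at the unique index `i` such that `(a, i)` is a
`y`-marked FPF-involution word, apply the Little bump, and forget the mark. -/
noncomputable def littleMap (y : Equiv.Perm ℤ) (a : List ℤ) : List ℤ :=
  (bump y (a, sInf {i : ℕ | Marked y (a, i)})).1

end FPFLittle

namespace FPFLittle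
open Equiv

/-! ### Words and products of simple transpositions -/

/-! A word acts on `Θ` by conjugation (`conjWord`), and `mem_RFPF_iff` says that the involution
words of `z` are the words of length `lenFPF z` carrying `Θ` to `z`. Everything combinatorial rests
on a strong exchange property for such words, `exists_delete_of_descent`: conjugation by a
rank-lowering transposition amounts to deleting a letter. With the chain property of the Bruhat
order it shows that covers raise the rank by exactly one (`covers_iff`), and it gives the existence
and uniqueness of markings.

If the marked letter is `x` and the suffix after it has product `S`, the crossing involves the lines
`l = S⁻¹ x` and `r = S⁻¹ (x + 1)`, and the whole word yields `(l r) y (l r)`. The operator `⇓`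
decrements the marked letter and then applies `flip`, which exchanges the two markings when the word
is neither reduced nor semi-reduced. Since `flip` is an involution, `⇓` is invertible on marked
words, with inverse `up`.

Decrementing makes the old lower line the new upper line, because the suffix is unchanged. On a
non-reduced word `flip` makes the upper line, or its image under `y`, the lower line
(`lowerLine_flip`). So a bump that starts with its lower line in the `y`-stable set `{p, q}` keeps
it there at every non-reduced stage, and stops at a reduced word with its upper line in `{p, q}`. By
`iUnion_PsiPlus` and `iUnion_PsiMinus` these two conditions describe exactly the domain and
codomain, and running `up` inverts the bump.

Termination: the unmarked letters always form one of the finitely many words of `y`, while the sum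
of all letters moves by one per step. The marked letter therefore escapes from the others, and an
isolated even letter makes the word reduced. -/

@[simp] lemma simple_mul_self (x : ℤ) : simple x * simple x = 1 := swap_mul_self _ _

@[simp] lemma simple_inv (x : ℤ) : (simple x)⁻¹ = simple x := swap_inv _ _

@[simp] lemma simple_simple (x i : ℤ) : simple x (simple x i) = i := by
  simp [simple]

@[simp] lemma wordProd_nil : wordProd [] = 1 := rfl

@[simp] lemma wordProd_cons (x : ℤ) (a : List ℤ) :
    wordProd (x :: a) = simple x * wordProd a := by simp [wordProd]

@[simp] lemma wordProd_append (a b : List ℤ) :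
    wordProd (a ++ b) = wordProd a * wordProd b := by simp [wordProd]

lemma simple_apply (x i : ℤ) :
    simple x i = if i = x then x + 1 else if i = x + 1 then x else i := by
  simp [simple, swap_apply_def]

/-- A simple transposition preserves the order of every pair but the one it exchanges. -/
lemma simple_lt_simple {x i j : ℤ} (h : i < j) (hx : ¬ (i = x ∧ j = x + 1)) :
    simple x i < simple x j := by
  simp only [simple_apply]
  split_ifs <;> omega

/-- The strong exchange property for words in `S_ℤ`. -/
lemma exists_delete_of_inversion (a : List ℤ) : ∀ {i j : ℤ}, i < j →
    wordProd a j < wordProd a i →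
    ∃ A x S, a = A ++ x :: S ∧ wordProd (A ++ S) = wordProd a * swap i j := by
  induction a using List.reverseRecOn with
  | nil => intro i j h h'; simp at h'; omega
  | append_singleton a x ih =>
    intro i j h h'
    by_cases hx : i = x ∧ j = x + 1
    · obtain ⟨rfl, rfl⟩ := hx
      refine ⟨a, i, [], rfl, ?_⟩
      have : simple i * swap i (i + 1) = 1 := simple_mul_self i
      simp [mul_assoc, this]
    · obtain ⟨A, y, S, rfl, hA⟩ := ih (simple_lt_simple h hx) (by simpa using h')
      refine ⟨A, y, S ++ [x], by simp, ?_⟩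
      have : swap (simple x i) (simple x j) = simple x * swap i j * (simple x)⁻¹ :=
        (swap_apply_apply _ _ _)
      rw [← List.append_assoc, wordProd_append, hA, this]
      simp [mul_assoc]

/-! ### Generation of `SZ` by simple transpositions -/

lemma one_mem_SZ : (1 : Perm ℤ) ∈ SZ := by simp [SZ]

lemma mem_SZ_iff (w : Perm ℤ) : w ∈ SZ ↔ w ∈ Subgroup.closure {t : Perm ℤ | t.IsSwap} := by
  rw [_root_.mem_closure_isSwap']
  rfl

lemma mul_mem_SZ {u v : Perm ℤ} (hu : u ∈ SZ) (hv : v ∈ SZ) : u * v ∈ SZ := by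
  rw [mem_SZ_iff] at *
  exact mul_mem hu hv

lemma swap_mem_SZ (i j : ℤ) : swap i j ∈ SZ := by
  by_cases h : i = j
  · subst h; rw [swap_self]; exact one_mem_SZ
  rw [mem_SZ_iff]
  exact Subgroup.subset_closure ⟨i, j, h, rfl⟩

lemma wordProd_mem_SZ (a : List ℤ) : wordProd a ∈ SZ := by
  induction a with
  | nil => exact one_mem_SZ
  | cons x a ih => rw [wordProd_cons]; exact mul_mem_SZ (swap_mem_SZ _ _) ih

lemma exists_wordProd_swap (i : ℤ) (n : ℕ) : ∃ a, wordProd a = swap i (i + n) := by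
  induction n with
  | zero => exact ⟨[], by simp [Perm.one_def]⟩
  | succ n ih =>
    obtain ⟨a, ha⟩ := ih
    by_cases hn : n = 0
    · subst hn; exact ⟨[i], by simp [simple]⟩
    refine ⟨[i + n] ++ a ++ [i + n], ?_⟩
    have h := swap_apply_apply (simple (i + n)) i (i + n)
    have h1 : simple (i + n) i = i := by
      rw [simple_apply, if_neg (by omega), if_neg (by omega)]
    have h2 : simple (i + n) (i + n) = i + (n + 1 : ℕ) := by
      rw [simple_apply, if_pos rfl]; push_cast; ring
    rw [h1, h2] at h
    rw [h]
    simp [ha, mul_assoc]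

lemma exists_wordProd {w : Perm ℤ} (hw : w ∈ SZ) : ∃ a, wordProd a = w := by
  rw [mem_SZ_iff] at hw
  induction hw using Subgroup.closure_induction with
  | mem t ht =>
    obtain ⟨i, j, hij, rfl⟩ := ht
    rcases le_total i j with h | h
    · obtain ⟨n, rfl⟩ := Int.exists_add_of_le h
      exact exists_wordProd_swap i n
    · obtain ⟨n, rfl⟩ := Int.exists_add_of_le h
      rw [swap_comm]
      exact exists_wordProd_swap j n
  | one => exact ⟨[], rfl⟩
  | mul u v _ _ hu hv =>
    obtain ⟨a, rfl⟩ := hu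
    obtain ⟨b, rfl⟩ := hv
    exact ⟨a ++ b, by simp⟩
  | inv u _ hu =>
    obtain ⟨a, rfl⟩ := hu
    refine ⟨a.reverse, ?_⟩
    clear * -
    induction a with
    | nil => simp
    | cons x a ih => simp [ih]

/-! ### The length of a permutation -/

lemma Inv_mul_simple {w : Perm ℤ} {x : ℤ} (h : w x < w (x + 1)) :
    Inv (w * simple x) = insert (x, x + 1) (Prod.map (simple x) (simple x) '' Inv w) := by
  ext ⟨i, j⟩
  simp only [Inv, Set.mem_ofPred_eq, Perm.mul_apply, Set.mem_insert_iff, Prod.mk.injEq,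
    Set.mem_image, Prod.exists, Prod.map_apply]
  constructor
  · rintro ⟨hij, hw⟩
    by_cases hx : i = x ∧ j = x + 1
    · exact Or.inl hx
    · exact Or.inr ⟨simple x i, simple x j, ⟨simple_lt_simple hij hx, hw⟩, by simp, by simp⟩
  · rintro (⟨rfl, rfl⟩ | ⟨i', j', ⟨hij, hw⟩, rfl, rfl⟩)
    · refine ⟨by omega, ?_⟩
      simpa [simple] using h
    · refine ⟨simple_lt_simple hij ?_, by simpa using hw⟩
      rintro ⟨rfl, rfl⟩
      omega

lemma len_mul_simple {w : Perm ℤ} {x : ℤ} (h : w x < w (x + 1)) (hf : (Inv w).Finite) :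
    (Inv (w * simple x)).Finite ∧ len (w * simple x) = len w + 1 := by
  have hinj : Function.Injective (Prod.map (simple x) (simple x)) :=
    (simple x).injective.prodMap (simple x).injective
  rw [len, Inv_mul_simple h]
  refine ⟨(hf.image _).insert _, ?_⟩
  rw [Set.ncard_insert_of_notMem _ (hf.image _), Set.ncard_image_of_injective _ hinj, len]
  rintro ⟨⟨i, j⟩, ⟨hij, -⟩, he⟩
  simp only [Prod.map_apply, Prod.mk.injEq] at he hij
  have h1 := congrArg (simple x) he.1
  have h2 := congrArg (simple x) he.2
  simp [simple] at h1 h2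
  omega

/-- In a shortest word the last letter must be an ascent of the preceding product, since otherwise
exchange would give a shorter word; hence each letter adds one inversion. -/
lemma len_of_minimal (a : List ℤ) (ha : ∀ b, wordProd b = wordProd a → a.length ≤ b.length) :
    (Inv (wordProd a)).Finite ∧ len (wordProd a) = a.length := by
  induction a using List.reverseRecOn with
  | nil =>
    have : Inv (1 : Perm ℤ) = ∅ := by
      ext ⟨i, j⟩; simp [Inv]; intro h; omega
    simp [len, this]
  | append_singleton a x ih =>
    have hmin : ∀ b, wordProd b = wordProd a → a.length ≤ b.length := fun b hb => by
      simpa using ha (b ++ [x]) (by simp [hb])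
    obtain ⟨hf, hl⟩ := ih hmin
    have hlt : wordProd a x < wordProd a (x + 1) := by
      by_contra hcon
      have hne : wordProd a x ≠ wordProd a (x + 1) := fun h => by
        have := (wordProd a).injective h; omega
      obtain ⟨A, y, S, rfl, hA⟩ := exists_delete_of_inversion a (lt_add_one x) (by omega)
      have := ha (A ++ S) (by rw [hA]; simp [simple, mul_assoc])
      simp at this
    have := len_mul_simple hlt hf
    simpa [hl] using this

lemma exists_minimal_of_exists {α : Type*} {P : List α → Prop} (h : ∃ a, P a) :
    ∃ a, P a ∧ ∀ b, P b → a.length ≤ b.length := by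
  classical
  have h' : ∃ n, ∃ a, P a ∧ a.length = n := by
    obtain ⟨a, ha⟩ := h; exact ⟨_, a, ha, rfl⟩
  obtain ⟨a, ha, hl⟩ := Nat.find_spec h'
  exact ⟨a, ha, fun b hb => hl ▸ Nat.find_min' h' ⟨b, hb, rfl⟩⟩

lemma exists_word_length_eq_len {w : Perm ℤ} (hw : w ∈ SZ) :
    ∃ a, wordProd a = w ∧ a.length = len w := by
  obtain ⟨a, rfl, h⟩ := exists_minimal_of_exists (exists_wordProd hw)
  exact ⟨a, rfl, (len_of_minimal a h).2.symm⟩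

lemma len_wordProd_le (a : List ℤ) : len (wordProd a) ≤ a.length := by
  obtain ⟨b, hb, h⟩ := exists_minimal_of_exists (P := fun b => wordProd b = wordProd a) ⟨a, rfl⟩
  rw [← hb, (len_of_minimal b fun c hc => h c (hc.trans hb)).2]
  exact h a rfl

@[simp] lemma simple_mul_simple_mul (x : ℤ) (w : Perm ℤ) : simple x * (simple x * w) = w := by
  rw [← mul_assoc, simple_mul_self, one_mul]

/-! ### Twisted conjugation of `Θ` by words -/

/-- Fixed-point-free involutions. -/
def IsFPF (z : Perm ℤ) : Prop := (∀ i, z (z i) = i) ∧ ∀ i, z i ≠ i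

lemma IsFPF.mul_self {z : Perm ℤ} (hz : IsFPF z) : z * z = 1 := by
  ext i; simp [hz.1]

lemma IsFPF.conj {z : Perm ℤ} (hz : IsFPF z) (w : Perm ℤ) : IsFPF (w⁻¹ * z * w) := by
  refine ⟨fun i => by simp [hz.1], fun i h => hz.2 (w i) ?_⟩
  exact Perm.inv_eq_iff_eq.1 h

lemma Theta_apply (i : ℤ) : Theta i = if Even i then i - 1 else i + 1 := rfl

lemma isFPF_Theta : IsFPF Theta := by
  refine ⟨Theta.left_inv, fun i => ?_⟩
  rw [Theta_apply]; split_ifs <;> omega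

lemma isFPF_of_mem_FZ {z : Perm ℤ} (hz : z ∈ FZ) : IsFPF z := by
  obtain ⟨w, -, rfl⟩ := hz
  exact isFPF_Theta.conj w

/-- The conjugate of `Θ` by the product of a word. -/
def conjWord (a : List ℤ) : Perm ℤ := (wordProd a)⁻¹ * Theta * wordProd a

@[simp] lemma conjWord_nil : conjWord [] = Theta := by simp [conjWord]

lemma conjWord_append (a b : List ℤ) :
    conjWord (a ++ b) = (wordProd b)⁻¹ * conjWord a * wordProd b := by
  simp [conjWord, mul_assoc]

lemma conjWord_append_singleton (a : List ℤ) (x : ℤ) :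
    conjWord (a ++ [x]) = simple x * conjWord a * simple x := by
  simp [conjWord, mul_assoc]

lemma conjWord_mem_FZ (a : List ℤ) : conjWord a ∈ FZ := ⟨_, wordProd_mem_SZ a, rfl⟩

lemma isFPF_conjWord (a : List ℤ) : IsFPF (conjWord a) := isFPF_Theta.conj _

lemma conjWord_congr {a b : List ℤ} (h : wordProd a = wordProd b) : conjWord a = conjWord b := by
  simp [conjWord, h]

lemma exists_conjWord {z : Perm ℤ} (hz : z ∈ FZ) : ∃ a, conjWord a = z := by
  obtain ⟨w, hw, rfl⟩ := hz
  obtain ⟨a, rfl⟩ := exists_wordProd hw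
  exact ⟨a, rfl⟩

lemma conj_swap_mem_FZ {z : Perm ℤ} (hz : z ∈ FZ) (i j : ℤ) :
    swap i j * z * swap i j ∈ FZ := by
  obtain ⟨w, hw, rfl⟩ := hz
  exact ⟨w * swap i j, mul_mem_SZ hw (swap_mem_SZ i j), by simp [mul_assoc]⟩

lemma conj_swap_conj_swap (z : Perm ℤ) (i j : ℤ) :
    swap i j * (swap i j * z * swap i j) * swap i j = z := by
  simp [mul_assoc]

lemma IsFPF.conj_swap_self {z : Perm ℤ} (hz : IsFPF z) (i : ℤ) :
    swap i (z i) * z * swap i (z i) = z := by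
  -- An involution `z` maps the pair `{i, z i}` to itself, so it commutes with the transposition of
  -- that pair.
  have hc := swap_apply_apply z i (z i)
  rw [hz.1, swap_comm] at hc
  nth_rw 1 [hc]
  simp [mul_assoc]

/-- Conjugating `z` by `(i, j)` is the same as conjugating it by `(z i, z j)`. -/
lemma IsFPF.conj_swap_apply {z : Perm ℤ} (hz : IsFPF z) (i j : ℤ) :
    swap (z i) (z j) * z * swap (z i) (z j) = swap i j * z * swap i j := by
  by_cases hij : z i = j
  · subst hij; rw [hz.1, swap_comm]
  have hji : z j ≠ i := fun h => hij (by rw [← h, hz.1])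
  have h1 := hz.2 i
  have h2 := hz.2 j
  by_cases h : i = j
  · subst h; simp
  have hz' : z i ≠ z j := fun h' => h (z.injective h')
  have hc : swap (z i) (z j) = z * swap i j * z⁻¹ := swap_apply_apply _ _ _
  have hzi : z⁻¹ = z := inv_eq_of_mul_eq_one_left hz.mul_self
  have hcomm : swap i j * swap (z i) (z j) = swap (z i) (z j) * swap i j := by
    have := swap_apply_apply (swap i j) (z i) (z j)
    rw [swap_apply_of_ne_of_ne h1 hij, swap_apply_of_ne_of_ne hji h2] at this
    nth_rw 2 [this]
    simp
  have e : z * swap (z i) (z j) = swap i j * z := by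
    rw [hc, hzi, ← mul_assoc, ← mul_assoc, hz.mul_self, one_mul]
  rw [mul_assoc, e, ← mul_assoc, ← hcomm, mul_assoc, mul_assoc, hc]
  simp

lemma Theta_inversion {i j : ℤ} (h : i < j) (h' : Theta j < Theta i) : Theta i = j := by
  rw [Theta_apply, Theta_apply] at *
  split_ifs at * with h1 h2 h2 <;> grind

/-- The strong exchange property for the words of fixed-point-free involutions. -/
lemma exists_delete_of_descent (a : List ℤ) : ∀ {i j : ℤ}, i < j →
    conjWord a j < conjWord a i → conjWord a i ≠ j →
    ∃ A x S, a = A ++ x :: S ∧ conjWord (A ++ S) = swap i j * conjWord a * swap i j := by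
  induction a using List.reverseRecOn with
  | nil =>
    -- The only inversions of `Θ` are its cycles, so the empty word satisfies the hypotheses
    -- vacuously.
    intro i j h h' hne
    exact absurd (Theta_inversion h (by simpa using h')) (by simpa using hne)
  | append_singleton a x ih =>
    intro i j h h' hne
    have hF := isFPF_conjWord (a ++ [x])
    have hs : conjWord a = simple x * conjWord (a ++ [x]) * simple x := by
      rw [conjWord_append_singleton]; simp [mul_assoc]
    set z := conjWord (a ++ [x]) with hz
    by_cases hx : i = x ∧ j = x + 1
    · obtain ⟨rfl, rfl⟩ := hx
      exact ⟨a, i, [], rfl, by rw [List.append_nil]; exact hs⟩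
    -- The last letter can also exchange the values rather than the positions; by
    -- `IsFPF.conj_swap_apply` conjugation by `(i, j)` is then again conjugation by the last letter.
    by_cases hx' : z j = x ∧ z i = x + 1
    · refine ⟨a, x, [], rfl, ?_⟩
      rw [← hF.conj_swap_apply, hx'.1, hx'.2, swap_comm, List.append_nil]
      exact hs
    · obtain ⟨A, y, S, rfl, hA⟩ := ih (simple_lt_simple h hx)
        (by simpa [hs] using simple_lt_simple h' hx') (by simpa [hs] using hne)
      refine ⟨A, y, S ++ [x], by simp, ?_⟩
      have : swap (simple x i) (simple x j) = simple x * swap i j * (simple x)⁻¹ :=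
        (swap_apply_apply _ _ _)
      rw [← List.append_assoc, conjWord_append_singleton, hA, this, hs]
      simp [mul_assoc]

/-! ### The rank function -/

/-- The ascent at `x` and its image under `z` each become an inversion, while the other inversions
are only relabelled. This doubling explains the factor ½ in the rank. -/
lemma Inv_diff_Cyc_conj_simple {z : Perm ℤ} (hz : IsFPF z) {x : ℤ} (h : z x < z (x + 1)) :
    Inv (simple x * z * simple x) \ Cyc (simple x * z * simple x) =
      insert (x, x + 1) (insert (z x, z (x + 1))
        (Prod.map (simple x) (simple x) '' (Inv z \ Cyc z))) := by
  have h1 := hz.2 x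
  have h2 := hz.2 (x + 1)
  have h3 : z x ≠ x + 1 := fun e => by
    have := hz.1 x; rw [e] at this; omega
  have h4 : z (x + 1) ≠ x := fun e => by
    have := hz.1 (x + 1); rw [e] at this; omega
  have s1 : simple x (z x) = z x := by rw [simple_apply, if_neg h1, if_neg h3]
  have s2 : simple x (z (x + 1)) = z (x + 1) := by rw [simple_apply, if_neg h4, if_neg h2]
  have s3 : simple x x = x + 1 := by simp [simple]
  have s4 : simple x (x + 1) = x := by simp [simple]
  ext ⟨i, j⟩
  simp only [Inv, Cyc, Set.mem_sdiff, Set.mem_ofPred_eq, Perm.mul_apply, Set.mem_insert_iff,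
    Prod.mk.injEq, Set.mem_image, Prod.exists, Prod.map_apply]
  constructor
  · rintro ⟨⟨hij, hw⟩, hc⟩
    by_cases hx : i = x ∧ j = x + 1
    · exact Or.inl hx
    by_cases hx' : simple x (z (simple x j)) = x ∧ simple x (z (simple x i)) = x + 1
    · right; left
      have e1 := congrArg (fun k => simple x (z (simple x k))) hx'.1
      have e2 := congrArg (fun k => simple x (z (simple x k))) hx'.2
      simp [hz.1, s1, s2, s3, s4] at e1 e2
      exact ⟨e2, e1⟩
    · refine Or.inr (Or.inr ⟨simple x i, simple x j, ⟨⟨simple_lt_simple hij hx, ?_⟩, ?_⟩,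
        by simp, by simp⟩)
      · simpa using simple_lt_simple hw hx'
      · rintro ⟨-, hc'⟩
        exact hc ⟨hij.le, by rw [hc']; simp⟩
  · rintro (⟨rfl, rfl⟩ | ⟨rfl, rfl⟩ | ⟨i', j', ⟨⟨hij, hw⟩, hc⟩, rfl, rfl⟩)
    · simp only [s1, s2, s3, s4]; omega
    · simp only [s1, s2, s3, s4, hz.1]; omega
    · simp only [simple_simple]
      refine ⟨⟨simple_lt_simple hij ?_, simple_lt_simple hw ?_⟩, ?_⟩
      · rintro ⟨rfl, rfl⟩
        omega
      · rintro ⟨e1, e2⟩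
        have e1' : j' = z x := by rw [← e1, hz.1]
        have e2' : i' = z (x + 1) := by rw [← e2, hz.1]
        omega
      · rintro ⟨-, hc'⟩
        exact hc ⟨hij.le, (simple x).injective hc'⟩

lemma ncard_conj_simple {z : Perm ℤ} (hz : IsFPF z) {x : ℤ} (h : z x < z (x + 1))
    (hf : (Inv z \ Cyc z).Finite) :
    (Inv (simple x * z * simple x) \ Cyc (simple x * z * simple x)).Finite ∧
    (Inv (simple x * z * simple x) \ Cyc (simple x * z * simple x)).ncard =
      (Inv z \ Cyc z).ncard + 2 := by
  have hinj : Function.Injective (Prod.map (simple x) (simple x)) :=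
    (simple x).injective.prodMap (simple x).injective
  have h1 := hz.2 x
  have h2 := hz.2 (x + 1)
  have h3 : z x ≠ x + 1 := fun e => by
    have := hz.1 x; rw [e] at this; omega
  have h4 : z (x + 1) ≠ x := fun e => by
    have := hz.1 (x + 1); rw [e] at this; omega
  rw [Inv_diff_Cyc_conj_simple hz h]
  refine ⟨((hf.image _).insert _).insert _, ?_⟩
  rw [Set.ncard_insert_of_notMem _ ((hf.image _).insert _),
    Set.ncard_insert_of_notMem _ (hf.image _), Set.ncard_image_of_injective _ hinj]
  · rintro ⟨⟨i, j⟩, ⟨⟨hij, hw⟩, -⟩, he⟩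
    simp only [Prod.map_apply, Prod.mk.injEq] at he hij hw
    have e1 := congrArg (simple x) he.1
    have e2 := congrArg (simple x) he.2
    rw [simple_simple, simple_apply, if_neg h1, if_neg h3] at e1
    rw [simple_simple, simple_apply, if_neg h4, if_neg h2] at e2
    rw [e1, e2, hz.1, hz.1] at hw
    omega
  · rintro (he | ⟨⟨i, j⟩, ⟨⟨hij, hw⟩, -⟩, he⟩)
    · simp only [Prod.mk.injEq] at he; omega
    simp only [Prod.map_apply, Prod.mk.injEq] at he hij hw
    have e1 := congrArg (simple x) he.1
    have e2 := congrArg (simple x) he.2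
    simp [simple] at e1 e2
    omega

lemma ncard_of_minimal (a : List ℤ) (ha : ∀ b, conjWord b = conjWord a → a.length ≤ b.length) :
    (Inv (conjWord a) \ Cyc (conjWord a)).Finite ∧
      (Inv (conjWord a) \ Cyc (conjWord a)).ncard = 2 * a.length := by
  induction a using List.reverseRecOn with
  | nil =>
    have : Inv Theta \ Cyc Theta = ∅ := by
      ext ⟨i, j⟩
      simp only [Inv, Cyc, Set.mem_sdiff, Set.mem_ofPred_eq, Set.mem_empty_iff_false, iff_false]
      rintro ⟨⟨h, h'⟩, hc⟩
      exact hc ⟨h.le, Theta_inversion h h'⟩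
    simp [this]
  | append_singleton a x ih =>
    have hmin : ∀ b, conjWord b = conjWord a → a.length ≤ b.length := fun b hb => by
      simpa using ha (b ++ [x]) (by simp only [conjWord_append_singleton, hb])
    obtain ⟨hf, hl⟩ := ih hmin
    have hF := isFPF_conjWord a
    have hlt : conjWord a x < conjWord a (x + 1) := by
      -- Minimality makes the last letter an ascent: if it closed a cycle it would act trivially,
      -- and at any other descent exchange would delete a letter.
      by_contra hcon
      have hne : conjWord a x ≠ conjWord a (x + 1) := fun h => by
        have := (conjWord a).injective h; omega
      by_cases hx : conjWord a x = x + 1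
      · have : conjWord (a ++ [x]) = conjWord a := by
          rw [conjWord_append_singleton, simple, ← hx, hF.conj_swap_self]
        have := ha a this.symm
        simp at this
      · obtain ⟨A, y, S, rfl, hA⟩ := exists_delete_of_descent a (lt_add_one x) (by omega) hx
        have := ha (A ++ S) (by rw [hA, conjWord_append_singleton]; rfl)
        simp at this
    have := ncard_conj_simple hF hlt hf
    rw [conjWord_append_singleton]
    refine ⟨this.1, ?_⟩
    rw [this.2, hl]; simp; ring

lemma exists_word_length_eq_lenFPF {z : Perm ℤ} (hz : z ∈ FZ) :
    ∃ a, conjWord a = z ∧ a.length = lenFPF z := by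
  obtain ⟨a, rfl, h⟩ := exists_minimal_of_exists (exists_conjWord hz)
  exact ⟨a, rfl, by rw [lenFPF, (ncard_of_minimal a h).2]; omega⟩

lemma finite_Inv_diff_Cyc {z : Perm ℤ} (hz : z ∈ FZ) : (Inv z \ Cyc z).Finite := by
  obtain ⟨a, rfl, h⟩ := exists_minimal_of_exists (exists_conjWord hz)
  exact (ncard_of_minimal a h).1

lemma lenFPF_conjWord_le (a : List ℤ) : lenFPF (conjWord a) ≤ a.length := by
  obtain ⟨b, hb, h⟩ := exists_minimal_of_exists (P := fun b => conjWord b = conjWord a) ⟨a, rfl⟩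
  rw [← hb, lenFPF, (ncard_of_minimal b fun c hc => h c (hc.trans hb)).2]
  have := h a rfl
  omega

/-- The involution words of `z` are the shortest words that conjugate `Θ` to `z`. -/
lemma mem_RFPF_iff (z : Perm ℤ) (a : List ℤ) :
    a ∈ RFPF z ↔ conjWord a = z ∧ a.length = lenFPF z := by
  simp only [RFPF, AFPF, RedWords, Set.mem_iUnion, Set.mem_ofPred_eq, exists_prop]
  have key : ∀ v ∈ SZ, z = v⁻¹ * Theta * v → lenFPF z ≤ len v := by
    rintro v hv rfl
    obtain ⟨b, rfl, hb⟩ := exists_word_length_eq_len hv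
    rw [← hb]
    exact lenFPF_conjWord_le b
  constructor
  · rintro ⟨w, ⟨hw, rfl, hmin⟩, rfl, hl⟩
    refine ⟨rfl, le_antisymm ?_ (lenFPF_conjWord_le a)⟩
    obtain ⟨b, hb, hb'⟩ := exists_word_length_eq_lenFPF (conjWord_mem_FZ a)
    rw [hl]
    change _ ≤ lenFPF (conjWord a)
    rw [← hb']
    exact (hmin _ (wordProd_mem_SZ b) hb.symm).trans (len_wordProd_le b)
  · rintro ⟨rfl, hl⟩
    have h1 := key _ (wordProd_mem_SZ a) rfl
    have h2 := len_wordProd_le a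
    refine ⟨wordProd a, ⟨wordProd_mem_SZ a, rfl, fun v hv hv' => ?_⟩, rfl, by omega⟩
    have := key v hv hv'
    omega

lemma mem_FZ_of_mem_RFPF {z : Perm ℤ} {a : List ℤ} (h : a ∈ RFPF z) : z ∈ FZ := by
  rw [mem_RFPF_iff] at h
  rw [← h.1]
  exact conjWord_mem_FZ a

lemma reduced_iff (a : List ℤ) : Reduced a ↔ a.length = lenFPF (conjWord a) := by
  constructor
  · rintro ⟨z, -, h⟩
    rw [mem_RFPF_iff] at h
    rw [h.1, h.2]
  · exact fun h => ⟨_, conjWord_mem_FZ a, (mem_RFPF_iff _ _).2 ⟨rfl, h⟩⟩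

lemma lenFPF_conj_swap_lt {z : Perm ℤ} (hz : z ∈ FZ) {i j : ℤ} (hij : i < j) (h : z j < z i)
    (hne : z i ≠ j) : lenFPF (swap i j * z * swap i j) < lenFPF z := by
  obtain ⟨a, rfl, ha⟩ := exists_word_length_eq_lenFPF hz
  obtain ⟨A, x, S, rfl, hA⟩ := exists_delete_of_descent a hij h hne
  rw [← hA, ← ha]
  have := lenFPF_conjWord_le (A ++ S)
  simp at *
  omega

lemma lenFPF_lt_conj_swap {z : Perm ℤ} (hz : z ∈ FZ) {i j : ℤ} (hij : i < j) (h : z i < z j) :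
    lenFPF z < lenFPF (swap i j * z * swap i j) := by
  have hF := isFPF_of_mem_FZ hz
  have h1 := hF.2 i
  have h2 := hF.2 j
  have h3 : z i ≠ j := fun e => by
    have := hF.1 i; rw [e] at this; omega
  have h4 : z j ≠ i := fun e => by
    have := hF.1 j; rw [e] at this; omega
  have := lenFPF_conj_swap_lt (conj_swap_mem_FZ hz i j) hij
    (by simpa [swap_apply_of_ne_of_ne, h1, h2, h3, h4] using h)
    (by simp [swap_apply_of_ne_of_ne, h2, h4])
  rwa [conj_swap_conj_swap] at this

/-- Conjugation by `(i, j)` raises the rank exactly when `z i < z j`, for `i < j`. -/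
lemma lenFPF_lt_conj_swap_iff {z : Perm ℤ} (hz : z ∈ FZ) {i j : ℤ} (hij : i < j) :
    lenFPF z < lenFPF (swap i j * z * swap i j) ↔ z i < z j := by
  refine ⟨fun h => ?_, lenFPF_lt_conj_swap hz hij⟩
  by_contra hcon
  by_cases hne : z i = j
  · subst hne
    rw [(isFPF_of_mem_FZ hz).conj_swap_self] at h
    exact lt_irrefl _ h
  · have : z i ≠ z j := fun e => hij.ne (z.injective e)
    exact lt_asymm h (lenFPF_conj_swap_lt hz hij (by omega) hne)

/-! ### The covers of the Bruhat order -/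

lemma bruhatStep_iff {z z' : Perm ℤ} : BruhatStep z z' ↔
    z ∈ FZ ∧ ∃ i j, i < j ∧ z i < z j ∧ z' = swap i j * z * swap i j := by
  constructor
  · rintro ⟨hz, t, ⟨i, j, hij, rfl⟩, rfl, h⟩
    refine ⟨hz, ?_⟩
    rcases lt_or_gt_of_ne hij with hlt | hlt
    · exact ⟨i, j, hlt, (lenFPF_lt_conj_swap_iff hz hlt).1 h, rfl⟩
    · rw [swap_comm] at h ⊢
      exact ⟨j, i, hlt, (lenFPF_lt_conj_swap_iff hz hlt).1 h, rfl⟩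
  · rintro ⟨hz, i, j, hij, h, rfl⟩
    exact ⟨hz, _, ⟨i, j, hij.ne, rfl⟩, rfl, lenFPF_lt_conj_swap hz hij h⟩

/-- Conjugation by a transposition that lowers the rank goes down in the Bruhat order. -/
lemma bruhatStep_of_conj_lt {z : Perm ℤ} (hz : z ∈ FZ) {i j : ℤ} (hij : i ≠ j)
    (h : lenFPF (swap i j * z * swap i j) < lenFPF z) :
    BruhatStep (swap i j * z * swap i j) z :=
  ⟨conj_swap_mem_FZ hz i j, swap i j, ⟨i, j, hij, rfl⟩, (conj_swap_conj_swap z i j).symm, h⟩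

lemma BruhatLT.lenFPF_lt {y z : Perm ℤ} (h : BruhatLT y z) : lenFPF y < lenFPF z := by
  induction h with
  | single h => exact h.2.choose_spec.2.2
  | tail _ h ih => exact ih.trans h.2.choose_spec.2.2

/-- A simple transposition preserves the order of positions and of values, except when the step is
conjugation by that very transposition. This is the lifting property used in the chain argument. -/
lemma BruhatStep.conj_simple {u v : Perm ℤ} (h : BruhatStep u v) (x : ℤ) :
    simple x * u * simple x = v ∨
      BruhatStep (simple x * u * simple x) (simple x * v * simple x) := by
  obtain ⟨hu, i, j, hij, hlt, rfl⟩ := bruhatStep_iff.1 h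
  by_cases hx : i = x ∧ j = x + 1
  · obtain ⟨rfl, rfl⟩ := hx
    exact Or.inl rfl
  by_cases hx' : u i = x ∧ u j = x + 1
  · left
    rw [← (isFPF_of_mem_FZ hu).conj_swap_apply, hx'.1, hx'.2]
    rfl
  · right
    refine bruhatStep_iff.2 ⟨conj_swap_mem_FZ hu _ _, simple x i, simple x j,
      simple_lt_simple hij hx, by simpa using simple_lt_simple hlt hx', ?_⟩
    have : swap (simple x i) (simple x j) = simple x * swap i j * (simple x)⁻¹ :=
      swap_apply_apply _ _ _
    rw [this]
    simp [mul_assoc]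

lemma BruhatLT.conj_simple {u v : Perm ℤ} (h : BruhatLT u v) (x : ℤ) :
    BruhatLE (simple x * u * simple x) v ∨
      BruhatLT (simple x * u * simple x) (simple x * v * simple x) := by
  induction h with
  | single h =>
    rcases h.conj_simple x with h | h
    · exact Or.inl (h ▸ .refl)
    · exact Or.inr (.single h)
  | tail _ h ih =>
    rcases ih with ih | ih
    · exact Or.inl (ih.tail h)
    · rcases h.conj_simple x with h | h
      · exact Or.inl (h ▸ ih.to_reflTransGen)
      · exact Or.inr (ih.tail h)

lemma lenFPF_conj_simple_le {z : Perm ℤ} (hz : z ∈ FZ) (x : ℤ) :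
    lenFPF (simple x * z * simple x) ≤ lenFPF z + 1 := by
  obtain ⟨a, rfl, ha⟩ := exists_word_length_eq_lenFPF hz
  rw [← conjWord_append_singleton, ← ha]
  simpa using lenFPF_conjWord_le (a ++ [x])

lemma bruhatLE_of_conj_simple_le {z : Perm ℤ} (hz : z ∈ FZ) {x : ℤ}
    (h : lenFPF (simple x * z * simple x) ≤ lenFPF z) :
    BruhatLE (simple x * z * simple x) z := by
  by_cases hx : z x = x + 1
  · have := (isFPF_of_mem_FZ hz).conj_swap_self x
    rw [hx] at this
    change simple x * z * simple x = z at this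
    rw [this]
    exact .refl
  · have hne : z x ≠ z (x + 1) := fun e => by
      have := z.injective e; omega
    have hlt : ¬ z x < z (x + 1) := fun hlt => h.not_gt (lenFPF_lt_conj_swap hz (by omega) hlt)
    exact .single (bruhatStep_of_conj_lt hz (by omega)
      (lenFPF_conj_swap_lt hz (by omega) (by omega) hx))

/-- The chain property of the Bruhat order on `FZ`. -/
lemma exists_between_of_descent (a : List ℤ) (ha : a.length = lenFPF (conjWord a)) :
    ∀ {i j : ℤ}, i < j → conjWord a j < conjWord a i → conjWord a i ≠ j →
    lenFPF (conjWord a) = lenFPF (swap i j * conjWord a * swap i j) + 1 ∨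
    ∃ x, BruhatLT (swap i j * conjWord a * swap i j) x ∧ BruhatLT x (conjWord a) := by
  induction a using List.reverseRecOn with
  | nil =>
    intro i j h h' hne
    exact absurd (Theta_inversion h (by simpa using h')) (by simpa using hne)
  | append_singleton a x ih =>
    have hF := isFPF_conjWord (a ++ [x])
    have hzF := conjWord_mem_FZ (a ++ [x])
    have hs : conjWord a = simple x * conjWord (a ++ [x]) * simple x := by
      rw [conjWord_append_singleton]; simp [mul_assoc]
    have hs' := conjWord_append_singleton a x
    have hle := lenFPF_conj_simple_le (conjWord_mem_FZ a) x
    rw [← hs'] at hle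
    have hle' := lenFPF_conjWord_le a
    rw [List.length_append, List.length_singleton] at ha
    intro i j h h' hne
    have hrank : lenFPF (conjWord (a ++ [x])) = lenFPF (conjWord a) + 1 := by omega
    have hz'z : BruhatLT (conjWord a) (conjWord (a ++ [x])) := by
      refine .single ?_
      rw [hs]
      exact bruhatStep_of_conj_lt hzF (by omega)
        (by change lenFPF (simple x * _ * simple x) < _; rw [← hs]; omega)
    by_cases hx : i = x ∧ j = x + 1
    · obtain ⟨rfl, rfl⟩ := hx
      left
      rw [hrank, hs]; rfl
    by_cases hx' : conjWord (a ++ [x]) j = x ∧ conjWord (a ++ [x]) i = x + 1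
    · left
      rw [hrank, hs, ← hF.conj_swap_apply i j, hx'.1, hx'.2, swap_comm]; rfl
    have hy'z' : BruhatStep (swap (simple x i) (simple x j) * conjWord a *
        swap (simple x i) (simple x j)) (conjWord a) := by
      refine bruhatStep_of_conj_lt (conjWord_mem_FZ a) (fun e => h.ne ((simple x).injective e))
        (lenFPF_conj_swap_lt (conjWord_mem_FZ a) (simple_lt_simple h hx)
        (by simpa [hs] using simple_lt_simple h' hx') (by simpa [hs] using hne))
    -- The induction compares `s y s` with `s z s`, where `s` is the last letter; the lifting
    -- property then carries the result back to `y` and `z`.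
    have hrec := ih (by omega) (simple_lt_simple h hx)
        (by simpa [hs] using simple_lt_simple h' hx') (by simpa [hs] using hne)
    have hconj : swap (simple x i) (simple x j) * conjWord a * swap (simple x i) (simple x j) =
        simple x * (swap i j * conjWord (a ++ [x]) * swap i j) * simple x := by
      have : swap (simple x i) (simple x j) = simple x * swap i j * (simple x)⁻¹ :=
        swap_apply_apply _ _ _
      rw [this, hs]
      simp [mul_assoc]
    rw [hconj] at hrec hy'z'
    have hyF := conj_swap_mem_FZ hzF i j
    set y := swap i j * conjWord (a ++ [x]) * swap i j with hy
    have hss : simple x * (simple x * y * simple x) * simple x = y := by simp [mul_assoc]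
    rcases hrec with hrec | ⟨w, hw1, hw2⟩
    · have hy' := conj_swap_mem_FZ hyF x (x + 1)
      change simple x * y * simple x ∈ FZ at hy'
      have hley := lenFPF_conj_simple_le hy' x
      rw [hss] at hley
      -- If the rank of `y` is less than that of `s z s`, then `y ≤ s y s < s z s < z`, and `s z s`
      -- lies strictly between.
      rcases hley.lt_or_eq with hlt | heq
      · right
        have := bruhatLE_of_conj_simple_le hy' (x := x) (by rw [hss]; omega)
        rw [hss] at this
        exact ⟨_, Relation.TransGen.tail' this hy'z', hz'z⟩
      · left; omega
    · right
      rcases hw1.conj_simple x with h1 | h1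
      · rw [hss] at h1
        exact ⟨_, Relation.TransGen.trans_right h1 hw2, hz'z⟩
      · rw [hss] at h1
        refine ⟨_, h1, ?_⟩
        rcases hw2.conj_simple x with h2 | h2
        · exact Relation.TransGen.trans_right h2 hz'z
        · rwa [← hs'] at h2

/-- The covers of the Bruhat order on `FZ`. -/
lemma covers_iff {y z : Perm ℤ} : Covers y z ↔
    y ∈ FZ ∧ (∃ i j, i < j ∧ y i < y j ∧ z = swap i j * y * swap i j) ∧
      lenFPF z = lenFPF y + 1 := by
  constructor
  · rintro ⟨hy, hz, h⟩
    refine ⟨hy, ?_⟩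
    have hyz : BruhatLT y z := by
      have : y ∈ ({y} : Set (Perm ℤ)) := rfl
      rw [← h] at this
      exact this.2.2
    have hbetween : ∀ w, BruhatLT y w → ¬ BruhatLT w z := by
      intro w h1 h2
      have hw : w ∈ FZ := by
        cases h2 using Relation.TransGen.head_induction_on with
        | single h => exact h.1
        | head h _ => exact h.1
      have : w ∈ ({y} : Set (Perm ℤ)) := h ▸ ⟨hw, h1.to_reflTransGen, h2⟩
      rw [Set.mem_singleton_iff] at this
      subst this
      exact lt_irrefl _ h1.lenFPF_lt
    have hstep : BruhatStep y z := by
      cases hyz with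
      | single h => exact h
      | tail h1 h2 => exact absurd (.single h2) (hbetween _ h1)
    obtain ⟨-, i, j, hij, hlt, rfl⟩ := bruhatStep_iff.1 hstep
    refine ⟨⟨i, j, hij, hlt, rfl⟩, ?_⟩
    obtain ⟨a, ha, hl⟩ := exists_word_length_eq_lenFPF hz
    have hF := isFPF_of_mem_FZ hy
    have h1 := hF.2 i
    have h2 := hF.2 j
    have h3 : y i ≠ j := fun e => by
      have := hF.1 i; rw [e] at this; omega
    have h4 : y j ≠ i := fun e => by
      have := hF.1 j; rw [e] at this; omega
    rw [← ha] at hl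
    have := exists_between_of_descent a hl hij
      (by simpa [ha, swap_apply_of_ne_of_ne, h1, h2, h3, h4] using hlt)
      (by simp [ha, swap_apply_of_ne_of_ne, h2, h4])
    rw [ha, conj_swap_conj_swap] at this
    rcases this with h | ⟨w, hw1, hw2⟩
    · exact h
    · exact absurd hw2 (hbetween w hw1)
  · rintro ⟨hy, ⟨i, j, hij, hlt, rfl⟩, hl⟩
    refine ⟨hy, conj_swap_mem_FZ hy i j, ?_⟩
    ext w
    simp only [Set.mem_ofPred_eq, Set.mem_singleton_iff]
    constructor
    · rintro ⟨-, h1, h2⟩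
      rcases Relation.reflTransGen_iff_eq_or_transGen.1 h1 with h | h
      · exact h
      · have := BruhatLT.lenFPF_lt h
        have := h2.lenFPF_lt
        omega
    · rintro rfl
      exact ⟨hy, .refl, .single (bruhatStep_iff.2 ⟨hy, i, j, hij, hlt, rfl⟩)⟩

/-! ### Marked words -/

lemma apply_inv_apply (w : Perm ℤ) (i : ℤ) : w (w⁻¹ i) = i := by simp


lemma marked_iff {y : Perm ℤ} {m : List ℤ × ℕ} : Marked y m ↔
    m.2 < m.1.length ∧ conjWord (m.1.eraseIdx m.2) = y ∧ m.1.length = lenFPF y + 1 := by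
  rw [Marked, mem_RFPF_iff]
  constructor
  · rintro ⟨h, h1, h2⟩
    rw [List.length_eraseIdx_of_lt h] at h2
    exact ⟨h, h1, by omega⟩
  · rintro ⟨h, h1, h2⟩
    refine ⟨h, h1, ?_⟩
    rw [List.length_eraseIdx_of_lt h]
    omega

lemma semiReduced_iff {m : List ℤ × ℕ} :
    SemiReduced m ↔ conjWord m.1 = conjWord (m.1.eraseIdx m.2) := Iff.rfl

lemma exists_eq_append_cons {α : Type*} {a : List α} {i : ℕ} (h : i < a.length) :
    ∃ A x S, a = A ++ x :: S ∧ i = A.length :=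
  ⟨a.take i, a[i], a.drop (i + 1), by simp, by simp; omega⟩

@[simp] lemma eraseIdx_append_cons {α : Type*} (A S : List α) (x : α) :
    (A ++ x :: S).eraseIdx A.length = A ++ S := by
  simp [List.eraseIdx_append]

/-- The line entering the marked crossing from below. -/
def lowerLine (m : List ℤ × ℕ) : ℤ := (wordProd (m.1.drop (m.2 + 1)))⁻¹ (m.1.getD m.2 0)

/-- The line entering the marked crossing from above. -/
def upperLine (m : List ℤ × ℕ) : ℤ := (wordProd (m.1.drop (m.2 + 1)))⁻¹ (m.1.getD m.2 0 + 1)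

@[simp] lemma lowerLine_append_cons (A S : List ℤ) (x : ℤ) :
    lowerLine (A ++ x :: S, A.length) = (wordProd S)⁻¹ x := by
  simp [lowerLine, List.drop_append, List.drop_eq_nil_of_le]

@[simp] lemma upperLine_append_cons (A S : List ℤ) (x : ℤ) :
    upperLine (A ++ x :: S, A.length) = (wordProd S)⁻¹ (x + 1) := by
  simp [upperLine, List.drop_append, List.drop_eq_nil_of_le]

lemma lowerLine_ne_upperLine (m : List ℤ × ℕ) : lowerLine m ≠ upperLine m := by
  intro h
  have := (wordProd (m.1.drop (m.2 + 1)))⁻¹.injective h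
  omega

lemma wordProd_append_cons (A S : List ℤ) (x : ℤ) : wordProd (A ++ x :: S) =
    wordProd (A ++ S) * swap ((wordProd S)⁻¹ x) ((wordProd S)⁻¹ (x + 1)) := by
  rw [swap_apply_apply]
  simp [simple, mul_assoc]

lemma conjWord_append_cons (A S : List ℤ) (x : ℤ) : conjWord (A ++ x :: S) =
    swap ((wordProd S)⁻¹ x) ((wordProd S)⁻¹ (x + 1)) * conjWord (A ++ S) *
      swap ((wordProd S)⁻¹ x) ((wordProd S)⁻¹ (x + 1)) := by
  rw [conjWord, wordProd_append_cons, conjWord]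
  simp [mul_assoc]

lemma conjWord_eq_conj_swap {m : List ℤ × ℕ} (h : m.2 < m.1.length) : conjWord m.1 =
    swap (lowerLine m) (upperLine m) * conjWord (m.1.eraseIdx m.2) *
      swap (lowerLine m) (upperLine m) := by
  obtain ⟨a, i⟩ := m
  obtain ⟨A, x, S, rfl, rfl⟩ := exists_eq_append_cons h
  simpa using conjWord_append_cons A S x

/-- Two different deletions give the same involution exactly when deleting both letters does not
change the involution. -/
lemma conjWord_delete_delete (A B C : List ℤ) (x x' : ℤ) :
    conjWord (A ++ B ++ C) = conjWord (A ++ x :: (B ++ x' :: C)) ↔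
      conjWord (A ++ (B ++ x' :: C)) = conjWord (A ++ x :: (B ++ C)) := by
  have h1 := conjWord_append_cons (A ++ B) C x'
  have h2 := conjWord_append_cons (A ++ x :: B) C x'
  simp only [List.append_assoc, List.cons_append] at h1 h2 ⊢
  -- Inserting `x'` in front of `C` conjugates by a transposition that depends only on `C` and `x'`,
  -- so the same conjugation relates both equations.
  rw [h1, h2]
  constructor
  · intro h; rw [h]; simp [mul_assoc]
  · intro h; rw [← h]; simp [mul_assoc]

lemma exists_eq_append_cons_append_cons {α : Type*} {a : List α} {i j : ℕ} (hij : i < j)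
    (h : j < a.length) : ∃ A x B x' C, a = A ++ x :: (B ++ x' :: C) ∧ i = A.length ∧
      j = (A ++ x :: B).length := by
  obtain ⟨D, x', C, rfl, rfl⟩ := exists_eq_append_cons h
  obtain ⟨A, x, B, rfl, rfl⟩ := exists_eq_append_cons hij
  exact ⟨A, x, B, x', C, by simp, rfl, rfl⟩

lemma conjWord_eraseIdx_eraseIdx_of_lt {a : List ℤ} {i j : ℕ} (hij : i < j) (h : j < a.length) :
    (a.eraseIdx i).eraseIdx (j - 1) = (a.eraseIdx j).eraseIdx i ∧
    (conjWord ((a.eraseIdx j).eraseIdx i) = conjWord a ↔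
      conjWord (a.eraseIdx i) = conjWord (a.eraseIdx j)) := by
  obtain ⟨A, x, B, x', C, rfl, rfl, rfl⟩ := exists_eq_append_cons_append_cons hij h
  have e1 : (A ++ x :: (B ++ x' :: C)).eraseIdx A.length = A ++ (B ++ x' :: C) := by simp
  have e2 : (A ++ x :: (B ++ x' :: C)).eraseIdx (A ++ x :: B).length = A ++ x :: (B ++ C) := by
    have := eraseIdx_append_cons (A ++ x :: B) C x'
    simpa only [List.append_assoc, List.cons_append] using this
  have e3 : (A ++ (B ++ x' :: C)).eraseIdx ((A ++ x :: B).length - 1) = A ++ B ++ C := by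
    have := eraseIdx_append_cons (A ++ B) C x'
    have hl : (A ++ x :: B).length - 1 = (A ++ B).length := by simp
    rw [hl, ← this, List.append_assoc]
  have e4 : (A ++ x :: (B ++ C)).eraseIdx A.length = A ++ B ++ C := by simp
  rw [e1, e2, e3, e4]
  exact ⟨rfl, conjWord_delete_delete A B C x x'⟩

/-- The conditional index is the position of the `j`-th letter of `a` once the `i`-th has been
removed. -/
lemma conjWord_eraseIdx_eraseIdx {a : List ℤ} {i j : ℕ} (hij : j ≠ i) (hi : i < a.length)
    (hj : j < a.length) :
    conjWord ((a.eraseIdx i).eraseIdx (if j < i then j else j - 1)) = conjWord a ↔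
      conjWord (a.eraseIdx j) = conjWord (a.eraseIdx i) := by
  rcases lt_or_gt_of_ne hij with h | h
  · rw [if_pos h]
    exact (conjWord_eraseIdx_eraseIdx_of_lt h hi).2
  · have := conjWord_eraseIdx_eraseIdx_of_lt h hj
    rw [if_neg (by omega), this.1, this.2, eq_comm]

/-- Different deletions from an involution word give different involutions. -/
lemma eraseIdx_injective_of_reduced {a : List ℤ} (ha : a.length = lenFPF (conjWord a)) {i j : ℕ}
    (hi : i < a.length) (hj : j < a.length)
    (h : conjWord (a.eraseIdx j) = conjWord (a.eraseIdx i)) : j = i := by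
  by_contra hij
  rw [← conjWord_eraseIdx_eraseIdx hij hi hj] at h
  have hle := lenFPF_conjWord_le ((a.eraseIdx i).eraseIdx (if j < i then j else j - 1))
  rw [h, ← ha] at hle
  have := List.length_eraseIdx_le (a.eraseIdx i) (if j < i then j else j - 1)
  rw [List.length_eraseIdx_of_lt hi] at this
  omega

lemma exists_eraseIdx_of_lenFPF_le (b : List ℤ) (i j : ℤ)
    (hne : swap i j * conjWord b * swap i j ≠ conjWord b)
    (hle : lenFPF (swap i j * conjWord b * swap i j) ≤ lenFPF (conjWord b)) :
    ∃ k < b.length, conjWord (b.eraseIdx k) = swap i j * conjWord b * swap i j := by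
  wlog hij : i < j generalizing i j
  · have hij' : i ≠ j := fun e => hne (by subst e; rw [swap_self]; rfl)
    rw [swap_comm] at hne hle ⊢
    exact this j i hne hle (by omega)
  have h1 : ¬ conjWord b i < conjWord b j := fun h =>
    hle.not_gt (lenFPF_lt_conj_swap (conjWord_mem_FZ b) hij h)
  have h2 : conjWord b i ≠ j := fun h =>
    hne (by rw [← h]; exact (isFPF_conjWord b).conj_swap_self i)
  have h3 : conjWord b i ≠ conjWord b j := fun h => hij.ne ((conjWord b).injective h)
  obtain ⟨A, x, S, rfl, hA⟩ := exists_delete_of_descent b hij (by omega) h2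
  exact ⟨A.length, by simp, by simpa using hA⟩

/-- A marked word that is neither reduced nor semi-reduced has exactly one other marking. -/
lemma existsUnique_marked {y : Perm ℤ} {m : List ℤ × ℕ} (hm : Marked y m)
    (hred : ¬ Reduced m.1) (hsemi : ¬ SemiReduced m) :
    ∃! j, j ≠ m.2 ∧ Marked y (m.1, j) := by
  obtain ⟨a, i⟩ := m
  obtain ⟨hi, hy, hl⟩ := marked_iff.1 hm
  rw [reduced_iff] at hred
  rw [semiReduced_iff] at hsemi
  simp only at hi hy hl hred hsemi
  have hc := conjWord_eq_conj_swap (m := (a, i)) hi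
  simp only at hc
  have hle := lenFPF_conjWord_le a
  have hlb := List.length_eraseIdx_of_lt hi
  -- Not being semi-reduced, the word changes `y`; not being reduced, it does not raise the rank.
  -- Exchange in the involution word of `y` then gives a second letter to delete, and deleting both
  -- letters has the same effect as deleting neither.
  have hex := exists_eraseIdx_of_lenFPF_le (a.eraseIdx i) (lowerLine (a, i)) (upperLine (a, i))
    (by rwa [← hc]) (by rw [← hc, hy]; omega)
  rw [← hc] at hex
  obtain ⟨k, hk, hka⟩ := hex
  refine ⟨if k < i then k else k + 1,
    ⟨by dsimp only; split_ifs <;> omega, marked_iff.2 ⟨?_, ?_, hl⟩⟩, ?_⟩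
  · dsimp only; split_ifs <;> omega
  · simp only
    rw [← hy, ← conjWord_eraseIdx_eraseIdx _ hi, ← hka]
    · congr 2; split_ifs <;> omega
    · split_ifs <;> omega
    · split_ifs <;> omega
  · rintro j ⟨hji, hj⟩
    obtain ⟨hj, hjy, -⟩ := marked_iff.1 hj
    simp only at hj hjy hji
    rw [← hy, ← conjWord_eraseIdx_eraseIdx hji hi hj, ← hka] at hjy
    have := eraseIdx_injective_of_reduced (a := a.eraseIdx i) (by rw [hy]; omega) hk
      (by split_ifs <;> omega) hjy
    split_ifs at * <;> omega

/-- A word of a cover of `y` has exactly one `y`-marking. -/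
lemma existsUnique_marked_of_covers {y z : Perm ℤ} (h : Covers y z) {a : List ℤ}
    (ha : a ∈ RFPF z) : ∃! i, Marked y (a, i) := by
  obtain ⟨hy, ⟨i, j, hij, hlt, rfl⟩, hl⟩ := covers_iff.1 h
  obtain ⟨hc, hla⟩ := (mem_RFPF_iff _ _).1 ha
  have hne : swap i j * conjWord a * swap i j ≠ conjWord a := by
    rw [hc, conj_swap_conj_swap]
    intro h
    rw [← h] at hl
    omega
  obtain ⟨k, hk, hka⟩ := exists_eraseIdx_of_lenFPF_le a i j hne
    (by rw [hc, conj_swap_conj_swap]; omega)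
  rw [hc, conj_swap_conj_swap] at hka
  refine ⟨k, marked_iff.2 ⟨hk, hka, by simp only; omega⟩, fun k' hk' => ?_⟩
  obtain ⟨h1, h2, -⟩ := marked_iff.1 hk'
  exact eraseIdx_injective_of_reduced (by rw [hc, hla]) hk h1 (h2.trans hka.symm)

/-! ### The lines through the marked crossings -/

/-- The conjugate takes `k` to `y l`; comparing this with its value computed from `(i, j)` leaves
only the pair `{i, j}` and its image under `y`. -/
lemma IsFPF.conj_swap_eq_conj_swap {y : Perm ℤ} (hy : IsFPF y) {i j k l : ℤ}
    (h : swap i j * y * swap i j = swap k l * y * swap k l)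
    (hne : swap i j * y * swap i j ≠ y) :
    (k = i ∧ l = j) ∨ (k = j ∧ l = i) ∨ (k = y i ∧ l = y j) ∨ (k = y j ∧ l = y i) := by
  have hij : i ≠ j := fun e => hne (by subst e; rw [swap_self]; rfl)
  have hkl : k ≠ l := fun e => hne (by rw [h]; subst e; rw [swap_self]; rfl)
  have hyij : y i ≠ j := fun e => hne (by rw [← e, hy.conj_swap_self])
  have hykl : y k ≠ l := fun e => hne (by rw [h, ← e, hy.conj_swap_self])
  have hyji : y j ≠ i := fun e => hyij (by rw [← e, hy.1])
  have hylk : y l ≠ k := fun e => hykl (by rw [← e, hy.1])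
  have key : (swap i j * y * swap i j) k = y l := by
    rw [h]; simp [swap_apply_of_ne_of_ne, hylk, hy.2]
  by_cases h1 : k = i
  · subst h1
    have : y j = y l := by
      simpa [swap_apply_of_ne_of_ne, hyji, hy.2] using key
    exact Or.inl ⟨rfl, (y.injective this).symm⟩
  by_cases h2 : k = j
  · subst h2
    have : y i = y l := by
      simpa [swap_apply_of_ne_of_ne, hyij, hy.2] using key
    exact Or.inr (Or.inl ⟨rfl, (y.injective this).symm⟩)
  by_cases h3 : k = y i
  · subst h3
    have : j = y l := by
      simpa [swap_apply_of_ne_of_ne, hyij, hy.2, hy.1] using key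
    exact Or.inr (Or.inr (Or.inl ⟨rfl, by rw [this, hy.1]⟩))
  by_cases h4 : k = y j
  · subst h4
    have : i = y l := by
      simpa [swap_apply_of_ne_of_ne, hyji, hy.2, hy.1] using key
    exact Or.inr (Or.inr (Or.inr ⟨rfl, by rw [this, hy.1]⟩))
  · have h5 : y k ≠ i := fun e => h3 (by rw [← e, hy.1])
    have h6 : y k ≠ j := fun e => h4 (by rw [← e, hy.1])
    have : y k = y l := by
      simpa [swap_apply_of_ne_of_ne, h1, h2, h5, h6] using key
    exact absurd (y.injective this) hkl

/-- Prefixes of an involution word are themselves shortest: a shorter replacement could be followed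
by the same suffix. -/
lemma length_le_of_conjWord_eq {P S P' : List ℤ}
    (hr : (P ++ S).length = lenFPF (conjWord (P ++ S))) (h : conjWord P' = conjWord P) :
    P.length ≤ P'.length := by
  have : conjWord (P' ++ S) = conjWord (P ++ S) := by
    rw [conjWord_append, conjWord_append, h]
  have hle := lenFPF_conjWord_le (P' ++ S)
  rw [this, ← hr] at hle
  simpa using hle

lemma ascent_of_reduced {P S : List ℤ} {x : ℤ}
    (hr : (P ++ x :: S).length = lenFPF (conjWord (P ++ x :: S))) :
    conjWord P x < conjWord P (x + 1) := by
  have hr' : (P ++ [x] ++ S).length = lenFPF (conjWord (P ++ [x] ++ S)) := by simpa using hr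
  by_contra hcon
  have hne : conjWord P x ≠ conjWord P (x + 1) := fun h => by
    have := (conjWord P).injective h; omega
  by_cases hx : conjWord P x = x + 1
  · have := length_le_of_conjWord_eq hr' (P' := P) (by
      rw [conjWord_append_singleton, simple, ← hx, (isFPF_conjWord P).conj_swap_self])
    simp at this
  · obtain ⟨A, y, B, rfl, hA⟩ := exists_delete_of_descent P (lt_add_one x) (by omega) hx
    have := length_le_of_conjWord_eq hr' (P' := A ++ B)
      (by rw [hA, conjWord_append_singleton]; rfl)
    simp at this

/-- If the two lines had already crossed in `S`, exchange would remove both `x` and a letter of `S`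
without changing the product. -/
lemma lowerLine_lt_upperLine_of_reduced {A S : List ℤ} {x : ℤ}
    (hr : (A ++ x :: S).length = lenFPF (conjWord (A ++ x :: S))) :
    (wordProd S)⁻¹ x < (wordProd S)⁻¹ (x + 1) := by
  by_contra hcon
  have hne : (wordProd S)⁻¹ x ≠ (wordProd S)⁻¹ (x + 1) := fun h => by
    have := (wordProd S)⁻¹.injective h; omega
  obtain ⟨B, b, C, rfl, hB⟩ := exists_delete_of_inversion S
    (i := (wordProd S)⁻¹ (x + 1)) (j := (wordProd S)⁻¹ x) (by omega) (by simp)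
  have : conjWord (A ++ (B ++ C)) = conjWord (A ++ x :: (B ++ b :: C)) := by
    apply conjWord_congr
    rw [wordProd_append, hB, swap_comm, swap_apply_apply]
    simp [simple, mul_assoc]
  have hle := lenFPF_conjWord_le (A ++ (B ++ C))
  rw [this, ← hr] at hle
  simp at hle

/-- Two markings of a word never keep the same line, nor two lines matched by `y`. -/
lemma lines_of_reduced_delete {A B C : List ℤ} {x x' : ℤ}
    (hr : (A ++ (B ++ x' :: C)).length = lenFPF (conjWord (A ++ (B ++ x' :: C)))) {l r : ℤ}
    (hl : wordProd (B ++ x' :: C) l = x) (hu : wordProd (B ++ x' :: C) r = x + 1) :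
    ¬ (wordProd C l = x' ∧ wordProd C r = x' + 1) ∧
    ¬ (wordProd C (conjWord (A ++ (B ++ x' :: C)) l) = x' ∧
      wordProd C (conjWord (A ++ (B ++ x' :: C)) r) = x' + 1) := by
  have hr' : (A ++ B ++ [x'] ++ C).length = lenFPF (conjWord (A ++ B ++ [x'] ++ C)) := by
    simpa using hr
  simp only [wordProd_append, wordProd_cons, Perm.mul_apply] at hl hu
  constructor
  -- The lines would cross at `x'` and again inside `B`, so deleting a letter of `B` could replace
  -- the letter `x'`.
  · rintro ⟨h1, h2⟩
    have s1 : simple x' x' = x' + 1 := by simp [simple]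
    have s2 : simple x' (x' + 1) = x' := by simp [simple]
    rw [h1, s1] at hl
    rw [h2, s2] at hu
    obtain ⟨D, b, E, rfl, hD⟩ := exists_delete_of_inversion B (lt_add_one x') (by omega)
    have := length_le_of_conjWord_eq hr' (P' := A ++ (D ++ E)) (conjWord_congr (by
      rw [wordProd_append, hD]; simp [simple, mul_assoc]))
    simp at this
  -- Now `B` inverts the pair `ζ x' < ζ (x' + 1)`. Conjugating `ζ` by this pair equals conjugating
  -- it by `(x', x' + 1)`, so deleting a letter of `B` again replaces `x'`.
  · rintro ⟨h1, h2⟩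
    have hasc := ascent_of_reduced (P := A ++ B) (x := x') (S := C) (by simpa using hr)
    have hF := isFPF_conjWord (A ++ B)
    have hy : conjWord (A ++ (B ++ x' :: C)) =
        (wordProd C)⁻¹ * (simple x' * conjWord (A ++ B) * simple x') * wordProd C := by
      rw [← conjWord_append_singleton, ← conjWord_append]; simp
    set ζ := conjWord (A ++ B) with hζ
    have n1 := hF.2 x'
    have n2 := hF.2 (x' + 1)
    have n3 : ζ x' ≠ x' + 1 := fun e => by
      have := hF.1 x'; rw [e] at this; omega
    have n4 : ζ (x' + 1) ≠ x' := fun e => by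
      have := hF.1 (x' + 1); rw [e] at this; omega
    have s1 : simple x' (ζ x') = ζ x' := by rw [simple_apply, if_neg n1, if_neg n3]
    have s2 : simple x' (ζ (x' + 1)) = ζ (x' + 1) := by rw [simple_apply, if_neg n4, if_neg n2]
    have s3 : simple x' x' = x' + 1 := by simp [simple]
    have s4 : simple x' (x' + 1) = x' := by simp [simple]
    simp only [hy, Perm.mul_apply, apply_inv_apply] at h1 h2
    have e1 := congrArg (fun k => simple x' (ζ (simple x' k))) h1
    have e2 := congrArg (fun k => simple x' (ζ (simple x' k))) h2
    simp only [simple_simple, hF.1, s1, s2, s3, s4] at e1 e2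
    rw [e1, s2] at hl
    rw [e2, s1] at hu
    obtain ⟨D, b, E, rfl, hD⟩ := exists_delete_of_inversion B hasc (by omega)
    have := length_le_of_conjWord_eq hr' (P' := A ++ (D ++ E)) (by
      rw [conjWord_append_singleton, ← hζ]
      change _ = swap x' (x' + 1) * ζ * swap x' (x' + 1)
      rw [← hF.conj_swap_apply, conjWord_append, hD, hζ, conjWord_append]
      simp [mul_assoc])
    simp at this

/-- Both markings give the same conjugate of `y`, which leaves four possibilities for their lines;
`lines_of_reduced_delete` excludes the two in which the order is kept. -/
lemma lowerLine_of_lt {y : Perm ℤ} {a : List ℤ} {i j : ℕ} (hij : i < j) (hi : Marked y (a, i))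
    (hj : Marked y (a, j)) (hne : conjWord a ≠ y) :
    (lowerLine (a, j) = upperLine (a, i) ∧ upperLine (a, j) = lowerLine (a, i)) ∨
    (lowerLine (a, j) = y (upperLine (a, i)) ∧ upperLine (a, j) = y (lowerLine (a, i))) := by
  obtain ⟨hi1, hi2, hi3⟩ := marked_iff.1 hi
  obtain ⟨hj1, hj2, -⟩ := marked_iff.1 hj
  have hli := List.length_eraseIdx_of_lt hi1
  have ci := conjWord_eq_conj_swap hi1
  have cj := conjWord_eq_conj_swap hj1
  rw [hi2] at ci
  rw [hj2] at cj
  simp only at *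
  have hyF : IsFPF y := by rw [← hi2]; exact isFPF_conjWord _
  have hred : (a.eraseIdx i).length = lenFPF (conjWord (a.eraseIdx i)) := by rw [hi2]; omega
  obtain ⟨A, x, B, x', C, rfl, rfl, rfl⟩ := exists_eq_append_cons_append_cons hij hj1
  have l1 := lowerLine_append_cons A (B ++ x' :: C) x
  have u1 := upperLine_append_cons A (B ++ x' :: C) x
  have l2 := lowerLine_append_cons (A ++ x :: B) C x'
  have u2 := upperLine_append_cons (A ++ x :: B) C x'
  rw [List.append_assoc, List.cons_append] at l2 u2
  rw [eraseIdx_append_cons] at hred hi2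
  have key := lines_of_reduced_delete hred (l := lowerLine (A ++ x :: (B ++ x' :: C), A.length))
    (r := upperLine (A ++ x :: (B ++ x' :: C), A.length)) (by rw [l1, apply_inv_apply])
    (by rw [u1, apply_inv_apply])
  rw [hi2] at key
  rcases hyF.conj_swap_eq_conj_swap (ci.symm.trans cj) (ci ▸ hne) with h | h | h | h
  · refine absurd ⟨?_, ?_⟩ key.1
    · rw [← h.1, l2, apply_inv_apply]
    · rw [← h.2, u2, apply_inv_apply]
  · exact Or.inl h
  · refine absurd ⟨?_, ?_⟩ key.2
    · rw [← h.1, l2, apply_inv_apply]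
    · rw [← h.2, u2, apply_inv_apply]
  · exact Or.inr h

/-- The lower line of the other marking is the upper line of the first one, up to `y`. -/
lemma lowerLine_of_ne {y : Perm ℤ} {a : List ℤ} {i j : ℕ} (hij : j ≠ i) (hi : Marked y (a, i))
    (hj : Marked y (a, j)) (hne : conjWord a ≠ y) :
    lowerLine (a, j) = upperLine (a, i) ∨ lowerLine (a, j) = y (upperLine (a, i)) := by
  rcases lt_or_gt_of_ne hij with h | h
  · have hyF : IsFPF y := by rw [← (marked_iff.1 hi).2.1]; exact isFPF_conjWord _
    rcases lowerLine_of_lt h hj hi hne with h | h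
    · exact Or.inl h.2.symm
    · exact Or.inr (by rw [h.2, hyF.1])
  · exact (lowerLine_of_lt h hi hj hne).imp And.left And.left

/-! ### Finiteness of the sets of words -/

lemma finite_RFPF_of_length (n : ℕ) :
    ∀ z : Perm ℤ, z ∈ FZ → {a | a ∈ RFPF z ∧ a.length = n}.Finite := by
  induction n with
  | zero =>
    exact fun z _ => (Set.finite_singleton []).subset fun a ha => List.eq_nil_of_length_eq_zero ha.2
  | succ n ih =>
    intro z hz
    -- The last letter of an involution word is a descent that is not a cycle, so only finitely many
    -- letters can occur there.
    have hD : {x : ℤ | (x, x + 1) ∈ Inv z \ Cyc z}.Finite :=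
      (finite_Inv_diff_Cyc hz).preimage (f := fun x : ℤ => (x, x + 1))
        fun _ _ _ _ h => (Prod.mk.inj h).1
    refine (hD.biUnion fun x _ => (ih (simple x * z * simple x)
      (conj_swap_mem_FZ hz x (x + 1))).image (· ++ [x])).subset ?_
    rintro b ⟨hb, hbn⟩
    obtain ⟨a, x, rfl⟩ := List.eq_nil_or_concat' b |>.resolve_left
      (by rintro rfl; simp at hbn)
    obtain ⟨rfl, hl⟩ := (mem_RFPF_iff _ _).1 hb
    have hs : conjWord a = simple x * conjWord (a ++ [x]) * simple x := by
      rw [conjWord_append_singleton]; simp [mul_assoc]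
    have h1 := lenFPF_conj_simple_le (conjWord_mem_FZ a) x
    rw [← conjWord_append_singleton] at h1
    have h2 := lenFPF_conjWord_le a
    rw [List.length_append, List.length_singleton] at hl hbn
    simp only [Set.mem_iUnion, Set.mem_image]
    refine ⟨x, ⟨⟨by simp, ?_⟩, ?_⟩, a, ⟨?_, by omega⟩, rfl⟩
    · by_contra hcon
      have hne : conjWord (a ++ [x]) x ≠ conjWord (a ++ [x]) (x + 1) := fun h => by
        have := (conjWord (a ++ [x])).injective h; omega
      have h := lenFPF_lt_conj_swap (conjWord_mem_FZ (a ++ [x])) (lt_add_one x)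
        (by simp only [not_lt] at hcon; omega)
      change _ < lenFPF (simple x * _ * simple x) at h
      rw [← hs] at h
      omega
    · rintro ⟨-, h⟩
      simp only at h
      have h' := (isFPF_conjWord (a ++ [x])).conj_swap_self x
      rw [h] at h'
      have := congrArg lenFPF (hs.trans h')
      omega
    · rw [← hs, mem_RFPF_iff]
      exact ⟨rfl, by omega⟩

lemma finite_RFPF (z : Perm ℤ) : (RFPF z).Finite := by
  by_cases hz : z ∈ FZ
  · exact (finite_RFPF_of_length (lenFPF z) z hz).subset
      fun a ha => ⟨ha, ((mem_RFPF_iff _ _).1 ha).2⟩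
  · exact Set.finite_empty.subset fun a ha => hz (mem_FZ_of_mem_RFPF ha)

/-! ### Shifting the marked letter -/

lemma modify_append_cons {α : Type*} (A S : List α) (x : α) (f : α → α) :
    (A ++ x :: S).modify A.length f = A ++ f x :: S := by
  induction A with
  | nil => simp
  | cons b A ih => simp [ih]

lemma Marked.modify {y : Perm ℤ} {m : List ℤ × ℕ} (hm : Marked y m) (f : ℤ → ℤ) :
    Marked y (m.1.modify m.2 f, m.2) := by
  refine ⟨by simpa using hm.1, ?_⟩
  simpa only [List.eraseIdx_modify_of_eq] using hm.2

/-- The word formed by incrementing the letter in the marked position. -/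
def incr (m : List ℤ × ℕ) : List ℤ := m.1.modify m.2 (fun x => x + 1)

lemma incr_decr (m : List ℤ × ℕ) : (incr (decr m, m.2), m.2) = m := by
  have : (fun x : ℤ => x + 1) ∘ (fun x => x - 1) = id := by funext x; simp
  simp [incr, decr, List.modify_modify_eq, this]

lemma decr_incr (m : List ℤ × ℕ) : (decr (incr m, m.2), m.2) = m := by
  have : (fun x : ℤ => x - 1) ∘ (fun x => x + 1) = id := by funext x; simp
  simp [incr, decr, List.modify_modify_eq, this]

lemma upperLine_decr {m : List ℤ × ℕ} (h : m.2 < m.1.length) :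
    upperLine (decr m, m.2) = lowerLine m := by
  obtain ⟨a, i⟩ := m
  obtain ⟨A, x, S, rfl, rfl⟩ := exists_eq_append_cons h
  rw [decr, modify_append_cons, upperLine_append_cons, lowerLine_append_cons, sub_add_cancel]

lemma lowerLine_incr {m : List ℤ × ℕ} (h : m.2 < m.1.length) :
    lowerLine (incr m, m.2) = upperLine m := by
  obtain ⟨a, i⟩ := m
  obtain ⟨A, x, S, rfl, rfl⟩ := exists_eq_append_cons h
  rw [incr, modify_append_cons, upperLine_append_cons, lowerLine_append_cons]

/-! ### Exchanging the two markings -/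

open Classical in
/-- Exchange the two markings of a word that is neither reduced nor semi-reduced. -/
noncomputable def flip (y : Perm ℤ) (m : List ℤ × ℕ) : List ℤ × ℕ :=
  if Reduced m.1 ∨ SemiReduced m then m else (m.1, sInf {j : ℕ | j ≠ m.2 ∧ Marked y (m.1, j)})

lemma down_eq_flip (y : Perm ℤ) (m : List ℤ × ℕ) : down y m = flip y (decr m, m.2) := rfl

lemma flip_of_or {y : Perm ℤ} {m : List ℤ × ℕ} (h : Reduced m.1 ∨ SemiReduced m) :
    flip y m = m := if_pos h

lemma flip_eq_iff {y : Perm ℤ} {m : List ℤ × ℕ} (hm : Marked y m)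
    (hr : ¬ Reduced m.1) (hs : ¬ SemiReduced m) (j : ℕ) :
    flip y m = (m.1, j) ↔ j ≠ m.2 ∧ Marked y (m.1, j) := by
  have h := existsUnique_marked hm hr hs
  have hmem := Nat.sInf_mem (s := {j : ℕ | j ≠ m.2 ∧ Marked y (m.1, j)}) h.exists
  rw [flip, if_neg (by tauto)]
  constructor
  · intro he
    rw [← (Prod.mk.inj he).2]
    exact hmem
  · intro hj
    rw [h.unique hmem hj]

@[simp] lemma flip_fst (y : Perm ℤ) (m : List ℤ × ℕ) : (flip y m).1 = m.1 := by
  rw [flip]; split_ifs <;> rfl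

lemma flip_of_not {y : Perm ℤ} {m : List ℤ × ℕ} (hm : Marked y m)
    (hr : ¬ Reduced m.1) (hs : ¬ SemiReduced m) :
    (flip y m).2 ≠ m.2 ∧ Marked y (m.1, (flip y m).2) :=
  (flip_eq_iff hm hr hs _).1 (by rw [← flip_fst y m])

lemma Marked.flip {y : Perm ℤ} {m : List ℤ × ℕ} (hm : Marked y m) : Marked y (flip y m) := by
  by_cases h : Reduced m.1 ∨ SemiReduced m
  · rwa [flip_of_or h]
  · rw [not_or] at h
    have := (flip_of_not hm h.1 h.2).2
    rwa [← flip_fst y m] at this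

lemma semiReduced_iff_of_marked {y : Perm ℤ} {m : List ℤ × ℕ} (hm : Marked y m) :
    SemiReduced m ↔ conjWord m.1 = y := by
  rw [semiReduced_iff, (marked_iff.1 hm).2.1]

lemma flip_flip {y : Perm ℤ} {m : List ℤ × ℕ} (hm : Marked y m) : flip y (flip y m) = m := by
  by_cases h : Reduced m.1 ∨ SemiReduced m
  · rw [flip_of_or h, flip_of_or h]
  · rw [not_or] at h
    have h1 := flip_of_not hm h.1 h.2
    have hs : ¬ SemiReduced (FPFLittle.flip y m) := by
      have := h.2
      rw [semiReduced_iff_of_marked hm] at this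
      rwa [semiReduced_iff_of_marked hm.flip, flip_fst]
    have := (flip_eq_iff hm.flip (by rw [flip_fst]; exact h.1) hs m.2).2
      ⟨h1.1.symm, by rw [flip_fst]; exact hm⟩
    rwa [flip_fst] at this

lemma lowerLine_flip {y : Perm ℤ} {m : List ℤ × ℕ} (hm : Marked y m) (hr : ¬ Reduced m.1) :
    lowerLine (flip y m) = upperLine m ∨ lowerLine (flip y m) = y (upperLine m) := by
  by_cases hs : SemiReduced m
  · rw [flip_of_or (Or.inr hs)]
    -- Here `flip` does nothing, but `(l r)` commutes with `y` only if `y` exchanges the two lines.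
    right
    rw [semiReduced_iff_of_marked hm] at hs
    obtain ⟨h1, h2, -⟩ := marked_iff.1 hm
    have hF : IsFPF y := h2 ▸ isFPF_conjWord _
    have hc := conjWord_eq_conj_swap h1
    rw [h2, hs] at hc
    have hne := lowerLine_ne_upperLine m
    by_contra hcon
    have e := congrArg (fun w : Perm ℤ => w (lowerLine m)) hc
    have hcon' : y (upperLine m) ≠ lowerLine m := fun e => hcon e.symm
    simp only [Perm.mul_apply, swap_apply_left] at e
    rw [swap_apply_of_ne_of_ne hcon' (hF.2 _)] at e
    exact hne (y.injective e)
  · have h1 := flip_of_not hm hr hs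
    have := lowerLine_of_ne (a := m.1) (i := m.2) h1.1 hm h1.2
      (by rwa [semiReduced_iff_of_marked hm] at hs)
    rwa [show (m.1, (flip y m).2) = flip y m by rw [← flip_fst y m]] at this

lemma upperLine_flip {y : Perm ℤ} {m : List ℤ × ℕ} (hm : Marked y m) (hr : ¬ Reduced m.1) :
    upperLine (flip y m) = lowerLine m ∨ upperLine (flip y m) = y (lowerLine m) := by
  have h := lowerLine_flip hm.flip (by rwa [flip_fst])
  rw [flip_flip hm] at h
  have hF : IsFPF y := (marked_iff.1 hm).2.1 ▸ isFPF_conjWord _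
  rcases h with h | h
  · exact Or.inl h.symm
  · exact Or.inr (by rw [h, hF.1])

lemma Marked.down {y : Perm ℤ} {m : List ℤ × ℕ} (hm : Marked y m) : Marked y (down y m) :=
  (hm.modify _).flip

/-- The inverse of the operator `⇓` on `y`-marked words. -/
noncomputable def up (y : Perm ℤ) (m : List ℤ × ℕ) : List ℤ × ℕ := (incr (flip y m), (flip y m).2)

lemma Marked.up {y : Perm ℤ} {m : List ℤ × ℕ} (hm : Marked y m) : Marked y (up y m) :=
  hm.flip.modify _

lemma up_down {y : Perm ℤ} {m : List ℤ × ℕ} (hm : Marked y m) : up y (down y m) = m := by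
  rw [up, down_eq_flip, flip_flip (m := (decr m, m.2)) (hm.modify _), incr_decr]

lemma down_up {y : Perm ℤ} {m : List ℤ × ℕ} (hm : Marked y m) : down y (up y m) = m := by
  rw [down_eq_flip, up, decr_incr, flip_flip hm]

/-! ### Termination -/

lemma wordProd_apply_eq_self {a : List ℤ} {i : ℤ} (h : ∀ b ∈ a, b ≠ i ∧ b + 1 ≠ i) :
    wordProd a i = i := by
  induction a with
  | nil => rfl
  | cons b a ih =>
    rw [wordProd_cons, Perm.mul_apply, ih fun c hc => h c (List.mem_cons_of_mem _ hc)]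
    have := h b List.mem_cons_self
    rw [simple_apply, if_neg (by omega), if_neg (by omega)]

/-- A marked even letter far from all other letters makes the word reduced. -/
lemma reduced_of_far_even {y : Perm ℤ} {A S : List ℤ} {x : ℤ}
    (hm : Marked y (A ++ x :: S, A.length)) (hx : Even x) (hfar : ∀ b ∈ A ++ S, 3 ≤ |b - x|) : Reduced (A ++ x :: S) := by
  obtain ⟨-, hy, hl⟩ := marked_iff.1 hm
  simp only [eraseIdx_append_cons] at hy hl
  have hfix : ∀ i, x - 1 ≤ i → i ≤ x + 2 → ∀ B : List ℤ, (∀ b ∈ B, b ∈ A ++ S) →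
      wordProd B i = i := by
    intro i h1 h2 B hB
    refine wordProd_apply_eq_self fun b hb => ?_
    have := hfar b (hB b hb)
    rw [le_abs] at this
    omega
  have hS : ∀ b ∈ S, b ∈ A ++ S := fun b hb => List.mem_append_right _ hb
  have hinv : ∀ i, x - 1 ≤ i → i ≤ x + 2 → ∀ B : List ℤ, (∀ b ∈ B, b ∈ A ++ S) →
      (wordProd B)⁻¹ i = i := fun i h1 h2 B hB =>
    Perm.inv_eq_iff_eq.2 (hfix i h1 h2 B hB).symm
  have hc := conjWord_append_cons A S x
  rw [hinv x (by omega) (by omega) S hS, hinv (x + 1) (by omega) (by omega) S hS] at hc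
  have hlt : conjWord (A ++ S) x < conjWord (A ++ S) (x + 1) := by
    simp only [conjWord, Perm.mul_apply]
    rw [hfix x (by omega) (by omega) _ (fun _ h => h),
      hfix (x + 1) (by omega) (by omega) _ (fun _ h => h), Theta_apply, Theta_apply, if_pos hx,
      if_neg (by rw [Int.not_even_iff_odd]; exact hx.add_one),
      hinv _ (by omega) (by omega) _ (fun _ h => h),
      hinv _ (by omega) (by omega) _ (fun _ h => h)]
    omega
  have h1 := lenFPF_lt_conj_swap (conjWord_mem_FZ _) (lt_add_one x) hlt
  have h2 := lenFPF_conjWord_le (A ++ x :: S)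
  rw [← hc] at h1
  rw [hy] at h1
  rw [reduced_iff]
  omega

lemma exists_bound_RFPF (y : Perm ℤ) :
    ∃ C : ℕ, ∀ a ∈ RFPF y, |a.sum| ≤ C ∧ ∀ b ∈ a, |b| ≤ C := by
  obtain ⟨C, hC⟩ := ((finite_RFPF y).image
    fun a => a.sum.natAbs + (a.map Int.natAbs).sum).bddAbove
  refine ⟨C, fun a ha => ?_⟩
  have h : a.sum.natAbs + (a.map Int.natAbs).sum ≤ C := hC ⟨a, ha, rfl⟩
  refine ⟨by rw [Int.abs_eq_natAbs]; omega, fun b hb => ?_⟩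
  rw [Int.abs_eq_natAbs]
  have := List.le_sum_of_mem (List.mem_map_of_mem (f := Int.natAbs) hb)
  omega

/-- The sign `ε` treats `down` and `up` together. -/
lemma exists_reduced_of_shift {y : Perm ℤ} (m : ℕ → List ℤ × ℕ) (hm : ∀ N, Marked y (m N)) (ε : ℤ)
    (hε : ε = 1 ∨ ε = -1)
    (hstep : ∀ N, (m (N + 1)).1 = (m N).1.modify (m N).2 (fun x => x + ε)) :
    ∃ N, 0 < N ∧ Reduced (m N).1 := by
  obtain ⟨C, hC⟩ := exists_bound_RFPF y
  have hsum : ∀ N : ℕ, (m N).1.sum = (m 0).1.sum + ε * N := by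
    intro N
    induction N with
    | zero => simp
    | succ N ih =>
      rw [hstep]
      obtain ⟨A, x, S, hA, hi⟩ := exists_eq_append_cons (hm N).1
      rw [hA] at ih
      rw [hA, hi, modify_append_cons]
      simp only [List.sum_append, List.sum_cons] at ih ⊢
      push_cast
      linarith
  -- The marked letter is the total sum minus the sum of the others. The two copies of `C` bound
  -- that sum and the letter compared with; the margin 10 exceeds the distance 4 needed.
  obtain ⟨N, hN⟩ : ∃ N : ℕ, (N : ℤ) = |(m 0).1.sum| + 2 * C + 10 := by
    refine ⟨(|(m 0).1.sum| + 2 * C + 10).toNat, Int.toNat_of_nonneg ?_⟩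
    have := abs_nonneg (m 0).1.sum
    omega
  obtain ⟨A, x, S, hA, hi⟩ := exists_eq_append_cons (hm N).1
  have hmN : m N = (A ++ x :: S, A.length) := Prod.ext hA hi
  have hM := hm N
  have hs := hsum N
  rw [hmN] at hM
  rw [hA] at hs
  simp only [List.sum_append, List.sum_cons] at hs
  obtain ⟨hC1, hC2⟩ := hC (A ++ S) (by simpa using hM.2)
  rw [List.sum_append, abs_le] at hC1
  have hfar : ∀ b ∈ A ++ S, 4 ≤ |b - x| := by
    intro b hb
    have h1 := hC2 b hb
    rw [abs_le] at h1
    have h2 := neg_abs_le (m 0).1.sum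
    have h3 := le_abs_self (m 0).1.sum
    rw [le_abs]
    rcases hε with rfl | rfl
    · right; linarith
    · left; linarith
  have habs := abs_nonneg (m 0).1.sum
  rcases Int.even_or_odd x with hx | hx
  · refine ⟨N, by omega, ?_⟩
    rw [hA]
    exact reduced_of_far_even hM hx fun b hb => le_trans (by norm_num) (hfar b hb)
  -- An isolated odd letter exchanges a cycle of `Θ` and is only semi-reduced. One more step makes
  -- it even, at a cost of one in the distance.
  · refine ⟨N + 1, by omega, ?_⟩
    have hM' := (hm N).modify (fun x => x + ε)
    rw [hstep]
    rw [hmN] at hM' ⊢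
    simp only [modify_append_cons] at hM' ⊢
    refine reduced_of_far_even hM' ?_ fun b hb => ?_
    · rcases hε with rfl | rfl
      · exact hx.add_one
      · exact hx.sub_odd odd_one
    · have := hfar b hb
      rw [le_abs] at this ⊢
      omega

lemma iterate_mem {α : Type*} {P : α → Prop} {f : α → α} (hf : ∀ x, P x → P (f x)) {x : α}
    (hx : P x) (n : ℕ) : P (f^[n] x) := by
  induction n with
  | zero => exact hx
  | succ n ih => rw [Function.iterate_succ_apply']; exact hf _ ih

lemma exists_reduced_down {y : Perm ℤ} {m : List ℤ × ℕ} (hm : Marked y m) :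
    ∃ N, 0 < N ∧ Reduced ((down y)^[N] m).1 := by
  refine exists_reduced_of_shift (fun N => (down y)^[N] m)
    (fun N => iterate_mem (fun _ h => h.down) hm N) (-1) (Or.inr rfl) fun N => ?_
  simp only [Function.iterate_succ_apply']
  rw [down_eq_flip, flip_fst, decr]
  rfl

lemma exists_reduced_up {y : Perm ℤ} {m : List ℤ × ℕ} (hm : Marked y m) :
    ∃ N, 0 < N ∧ Reduced ((up y)^[N] m).1 := by
  -- The letter that `up` increments is the one marked after `flip`, so the shifted sequence
  -- consists of the flipped words; their underlying words are the same.
  have := exists_reduced_of_shift (fun N => flip y ((up y)^[N] m))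
    (fun N => (iterate_mem (fun _ h => h.up) hm N).flip) 1 (Or.inl rfl) fun N => ?_
  · simpa using this
  · simp only [Function.iterate_succ_apply', flip_fst]
    rw [up, incr, flip_fst]

/-! ### The Little bump -/

lemma bump_spec {y : Perm ℤ} {m : List ℤ × ℕ} (hm : Marked y m) :
    ∃ N, 0 < N ∧ bump y m = (down y)^[N] m ∧ Reduced ((down y)^[N] m).1 ∧
      ∀ k, 0 < k → k < N → ¬ Reduced ((down y)^[k] m).1 := by
  have h := Nat.sInf_mem (s := {N : ℕ | 0 < N ∧ Reduced ((down y)^[N] m).1})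
    (exists_reduced_down hm)
  exact ⟨_, h.1, rfl, h.2, fun k hk hkN hr => Nat.notMem_of_lt_sInf hkN ⟨hk, hr⟩⟩

lemma bump_eq {y : Perm ℤ} {m : List ℤ × ℕ} {N : ℕ} (hm : Marked y m) (hN : 0 < N)
    (hr : Reduced ((down y)^[N] m).1) (hk : ∀ k, 0 < k → k < N → ¬ Reduced ((down y)^[k] m).1) :
    bump y m = (down y)^[N] m := by
  obtain ⟨M, hM, he, hMr, hMk⟩ := bump_spec hm
  rcases lt_trichotomy M N with h | h | h
  · exact absurd hMr (hk M hM h)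
  · rw [he, h]
  · exact absurd hr (hMk N hN h)

lemma Marked.bump {y : Perm ℤ} {m : List ℤ × ℕ} (hm : Marked y m) : Marked y (bump y m) :=
  iterate_mem (fun _ h => h.down) hm _

lemma iterate_down_injOn {y : Perm ℤ} (n : ℕ) {m m' : List ℤ × ℕ} (hm : Marked y m)
    (hm' : Marked y m') (h : (down y)^[n] m = (down y)^[n] m') : m = m' := by
  induction n with
  | zero => exact h
  | succ n ih =>
    rw [Function.iterate_succ_apply', Function.iterate_succ_apply'] at h
    have hup := congrArg (up y) h
    rw [up_down (iterate_mem (fun _ h => h.down) hm n),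
      up_down (iterate_mem (fun _ h => h.down) hm' n)] at hup
    exact ih hup

lemma bump_injOn {y : Perm ℤ} {m m' : List ℤ × ℕ} (hm : Marked y m) (hm' : Marked y m')
    (hr : Reduced m.1) (hr' : Reduced m'.1) (h : bump y m = bump y m') : m = m' := by
  obtain ⟨N, hN, he, -, hk⟩ := bump_spec hm
  obtain ⟨N', hN', he', -, hk'⟩ := bump_spec hm'
  wlog hle : N ≤ N' generalizing m m' N N'
  · exact (this hm' hm hr' hr h.symm N' hN' he' hk' N hN he hk (by omega)).symm
  obtain ⟨d, rfl⟩ := Nat.exists_eq_add_of_le hle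
  rw [he, he', Function.iterate_add_apply] at h
  -- Cancelling the common `N` steps puts `m` on the orbit of `m'`; if `d > 0`, reducedness of `m`
  -- would have stopped the bump of `m'` earlier.
  have := iterate_down_injOn N hm (iterate_mem (fun _ h => h.down) hm' d) h
  rcases Nat.eq_zero_or_pos d with rfl | hd
  · exact this
  · exact absurd (this ▸ hr) (hk' d hd (by omega))

/-! ### Lines followed along the bump -/

section Lines

variable {y : Perm ℤ} {K : ℤ → Prop}

lemma down_lines (hK : ∀ l, K l → K (y l)) {m : List ℤ × ℕ} (hm : Marked y m)
    (hl : K (lowerLine m)) :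
    (Reduced (down y m).1 → K (upperLine (down y m))) ∧
    (¬ Reduced (down y m).1 → K (lowerLine (down y m))) := by
  have hu : K (upperLine (decr m, m.2)) := by rwa [upperLine_decr hm.1]
  rw [down_eq_flip, flip_fst]
  constructor
  · intro hr
    rwa [flip_of_or (Or.inl hr)]
  · intro hr
    rcases lowerLine_flip (m := (decr m, m.2)) (hm.modify _) hr with h | h
    · rwa [h]
    · rw [h]; exact hK _ hu

lemma upperLine_bump (hK : ∀ l, K l → K (y l)) {m : List ℤ × ℕ} (hm : Marked y m)
    (hl : K (lowerLine m)) : K (upperLine (bump y m)) := by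
  obtain ⟨N, hN, he, hr, hk⟩ := bump_spec hm
  have key : ∀ k, k < N → K (lowerLine ((down y)^[k] m)) := by
    intro k
    induction k with
    | zero => exact fun _ => hl
    | succ k ih =>
      intro hkN
      have := hk (k + 1) (by omega) hkN
      rw [Function.iterate_succ_apply'] at this ⊢
      exact (down_lines hK (iterate_mem (fun _ h => h.down) hm k) (ih (by omega))).2 this
  obtain ⟨k, rfl⟩ := Nat.exists_eq_succ_of_ne_zero hN.ne'
  rw [Nat.succ_eq_add_one, Function.iterate_succ_apply'] at he hr
  rw [he]
  exact (down_lines hK (iterate_mem (fun _ h => h.down) hm k) (key k (by omega))).1 hr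

lemma lowerLine_up (hK : ∀ l, K l → K (y l)) {m : List ℤ × ℕ} (hm : Marked y m)
    (hu : Reduced m.1 → K (upperLine m)) (hl : ¬ Reduced m.1 → K (lowerLine m)) :
    K (lowerLine (up y m)) := by
  rw [up, lowerLine_incr hm.flip.1]
  by_cases hr : Reduced m.1
  · rw [flip_of_or (Or.inl hr)]
    exact hu hr
  · rcases upperLine_flip hm hr with h' | h'
    · rw [h']; exact hl hr
    · rw [h']; exact hK _ (hl hr)

/-- A preimage is the first reduced word reached by `up`: no intermediate word is reduced, so the
bump from there stops exactly at `m`. -/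
lemma exists_bump_eq (hK : ∀ l, K l → K (y l)) {m : List ℤ × ℕ} (hm : Marked y m)
    (hr : Reduced m.1) (hu : K (upperLine m)) :
    ∃ m', Marked y m' ∧ Reduced m'.1 ∧ K (lowerLine m') ∧ bump y m' = m := by
  classical
  have hex := exists_reduced_up hm
  obtain ⟨hN, hNr⟩ := Nat.find_spec hex
  have hmin : ∀ k, 0 < k → k < Nat.find hex → ¬ Reduced ((up y)^[k] m).1 :=
    fun k hk hkN h => Nat.find_min hex hkN ⟨hk, h⟩
  generalize Nat.find hex = N at *
  have hM : ∀ k, Marked y ((up y)^[k] m) := fun k => iterate_mem (fun _ h => h.up) hm k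
  have hdown : ∀ k j, (down y)^[k] ((up y)^[k + j] m) = (up y)^[j] m := by
    intro k
    induction k with
    | zero => intro j; simp
    | succ k ih =>
      intro j
      rw [Function.iterate_succ_apply, show k + 1 + j = (k + j) + 1 by ring,
        Function.iterate_succ_apply', down_up (hM _), ih]
  have hlow : ∀ k, k < N → K (lowerLine ((up y)^[k + 1] m)) := by
    intro k
    induction k with
    | zero =>
      exact fun _ => lowerLine_up hK hm (fun _ => hu) fun h => absurd hr h
    | succ k ih =>
      intro hkN
      rw [Function.iterate_succ_apply']
      exact lowerLine_up hK (hM _) (fun h => absurd h (hmin _ (by omega) hkN))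
        fun _ => ih (by omega)
  refine ⟨(up y)^[N] m, hM N, hNr, ?_, ?_⟩
  · have := hlow (N - 1) (by omega)
    rwa [Nat.sub_add_cancel hN] at this
  · have h0 := hdown N 0
    rw [Nat.add_zero] at h0
    have := bump_eq (hM N) hN (by rw [h0]; exact hr) fun k hk hkN => by
      have := hdown k (N - k)
      rw [Nat.add_sub_cancel' hkN.le] at this
      rw [this]
      exact hmin _ (by omega) (by omega)
    rw [this, h0]
    rfl

end Lines

/-! ### The Little map -/

lemma marked_index_unique {y : Perm ℤ} {a : List ℤ} (hr : Reduced a) {i j : ℕ}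
    (hi : Marked y (a, i)) (hj : Marked y (a, j)) : j = i :=
  eraseIdx_injective_of_reduced ((reduced_iff a).1 hr) hi.1 hj.1
    ((marked_iff.1 hj).2.1.trans (marked_iff.1 hi).2.1.symm)

lemma littleMap_eq {y : Perm ℤ} {a : List ℤ} {i : ℕ} (hr : Reduced a) (hi : Marked y (a, i)) :
    littleMap y a = (bump y (a, i)).1 := by
  have := Nat.sInf_mem (s := {i : ℕ | Marked y (a, i)}) ⟨i, hi⟩
  rw [littleMap, marked_index_unique hr hi this]

/-- The Little map on the reduced marked words whose lower line satisfies `K`. -/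
lemma littleMap_bijOn {y : Perm ℤ} {K : ℤ → Prop} (hK : ∀ l, K l → K (y l)) :
    Set.BijOn (littleMap y) {a | ∃ i, Marked y (a, i) ∧ Reduced a ∧ K (lowerLine (a, i))}
      {a | ∃ i, Marked y (a, i) ∧ Reduced a ∧ K (upperLine (a, i))} := by
  have hred : ∀ {m : List ℤ × ℕ}, Marked y m → Reduced (bump y m).1 := by
    intro m hm
    obtain ⟨N, -, he, hr, -⟩ := bump_spec hm
    rwa [he]
  refine ⟨?_, ?_, ?_⟩
  · rintro a ⟨i, hi, hr, hl⟩
    rw [littleMap_eq hr hi]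
    exact ⟨_, hi.bump, hred hi, upperLine_bump hK hi hl⟩
  · rintro a ⟨i, hi, hr, -⟩ b ⟨j, hj, hr', -⟩ h
    rw [littleMap_eq hr hi, littleMap_eq hr' hj] at h
    have h1 := hi.bump
    have h2 := hj.bump
    have h3 := hred hi
    have : bump y (a, i) = bump y (b, j) := by
      refine Prod.ext h ?_
      generalize bump y (a, i) = m at *
      generalize bump y (b, j) = m' at *
      obtain ⟨c, k⟩ := m
      obtain ⟨c', k'⟩ := m'
      simp only at h
      subst h
      exact marked_index_unique h3 h2 h1
    exact (Prod.mk.inj (bump_injOn hi hj hr hr' this)).1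
  · rintro b ⟨j, hj, hr, hu⟩
    obtain ⟨⟨a, i⟩, hm, hmr, hl, he⟩ := exists_bump_eq hK hj hr hu
    exact ⟨a, ⟨i, hm, hmr, hl⟩, by rw [littleMap_eq hmr hm, he]⟩

/-! ### The words of the covers -/

lemma Marked.lower_lt_upper {y : Perm ℤ} {m : List ℤ × ℕ} (hm : Marked y m) (hr : Reduced m.1) :
    lowerLine m < upperLine m := by
  obtain ⟨a, i⟩ := m
  obtain ⟨A, x, S, rfl, rfl⟩ := exists_eq_append_cons hm.1
  rw [lowerLine_append_cons, upperLine_append_cons]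
  exact lowerLine_lt_upperLine_of_reduced ((reduced_iff _).1 hr)

lemma conjWord_eq_of_marked {y : Perm ℤ} {m : List ℤ × ℕ} (hm : Marked y m) :
    conjWord m.1 = swap (lowerLine m) (upperLine m) * y * swap (lowerLine m) (upperLine m) := by
  have := conjWord_eq_conj_swap hm.1
  rwa [(marked_iff.1 hm).2.1] at this

lemma Marked.covers {y : Perm ℤ} {m : List ℤ × ℕ} (hm : Marked y m) (hr : Reduced m.1) :
    Covers y (conjWord m.1) ∧ y (lowerLine m) < y (upperLine m) := by
  have hlt := hm.lower_lt_upper hr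
  have hc := conjWord_eq_of_marked hm
  obtain ⟨-, h1, h2⟩ := marked_iff.1 hm
  have hy : y ∈ FZ := h1 ▸ conjWord_mem_FZ _
  have hl : lenFPF (conjWord m.1) = lenFPF y + 1 := by rw [← (reduced_iff _).1 hr, h2]
  have hlt' : y (lowerLine m) < y (upperLine m) := by
    rw [← lenFPF_lt_conj_swap_iff hy hlt, ← hc]
    omega
  exact ⟨covers_iff.2 ⟨hy, ⟨_, _, hlt, hlt', hc⟩, hl⟩, hlt'⟩

lemma exists_marked_of_covers {y z : Perm ℤ} (h : Covers y z) {a : List ℤ} (ha : a ∈ RFPF z)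
    {i j : ℤ} (hij : i < j) (hz : z = swap i j * y * swap i j) :
    y i < y j ∧ ∃ k, Marked y (a, k) ∧ Reduced a ∧ lowerLine (a, k) < upperLine (a, k) ∧
    ((lowerLine (a, k) = i ∧ upperLine (a, k) = j) ∨
      (lowerLine (a, k) = j ∧ upperLine (a, k) = i) ∨
      (lowerLine (a, k) = y i ∧ upperLine (a, k) = y j) ∨
      (lowerLine (a, k) = y j ∧ upperLine (a, k) = y i)) := by
  obtain ⟨k, hk, -⟩ := existsUnique_marked_of_covers h ha
  have hr : Reduced a := ⟨z, h.2.1, ha⟩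
  obtain ⟨hy, -, hl⟩ := covers_iff.1 h
  have hc := conjWord_eq_of_marked hk
  rw [((mem_RFPF_iff _ _).1 ha).1, hz] at hc
  rw [hz] at hl
  have hlt : y i < y j := by
    rw [← lenFPF_lt_conj_swap_iff hy hij]
    omega
  refine ⟨hlt, k, hk, hr, hk.lower_lt_upper hr,
    (isFPF_of_mem_FZ hy).conj_swap_eq_conj_swap hc fun e => ?_⟩
  rw [e] at hl
  omega

variable {y : Perm ℤ} {p q : ℤ}

lemma iUnion_PsiPlus (hy : IsFPF y) (hp : y p = q) :
    (⋃ z ∈ PsiPlus y q, RFPF z) =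
      {a | ∃ i, Marked y (a, i) ∧ Reduced a ∧ (lowerLine (a, i) = p ∨ lowerLine (a, i) = q)} := by
  have hq : y q = p := by rw [← hp, hy.1]
  ext a
  simp only [Set.mem_iUnion, Set.mem_ofPred_eq, exists_prop]
  constructor
  · rintro ⟨z, ⟨hc, j, hj, hz⟩, ha⟩
    obtain ⟨hlt, k, hk, hr, hlu, h⟩ := exists_marked_of_covers hc ha hj hz
    refine ⟨k, hk, hr, ?_⟩
    rw [hq] at hlt h
    -- The inequalities `q < j` and `p < y j` exclude `j` and `y j` as lower lines.
    omega
  · rintro ⟨i, hi, hr, h⟩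
    obtain ⟨hc, hlt⟩ := hi.covers hr
    have hlu := hi.lower_lt_upper hr
    have hz := conjWord_eq_of_marked hi
    refine ⟨conjWord a, ⟨hc, ?_⟩, (mem_RFPF_iff _ _).2 ⟨rfl, (reduced_iff a).1 hr⟩⟩
    -- If the lower line is `p` and the upper one `r`, the pair `(p, r)` is replaced by its image
    -- `(q, y r)`, where `q = y p < y r`.
    rcases h with h | h
    · refine ⟨y (upperLine (a, i)), by rwa [h, hp] at hlt, ?_⟩
      rw [hz, ← hy.conj_swap_apply, h, hp]
    · exact ⟨upperLine (a, i), by rwa [h] at hlu, by rw [hz, h]⟩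

lemma iUnion_PsiMinus (hy : IsFPF y) (hp : y p = q) :
    (⋃ z ∈ PsiMinus y p, RFPF z) =
      {a | ∃ i, Marked y (a, i) ∧ Reduced a ∧ (upperLine (a, i) = p ∨ upperLine (a, i) = q)} := by
  have hq : y q = p := by rw [← hp, hy.1]
  ext a
  simp only [Set.mem_iUnion, Set.mem_ofPred_eq, exists_prop]
  constructor
  · rintro ⟨z, ⟨hc, j, hj, hz⟩, ha⟩
    obtain ⟨hlt, k, hk, hr, hlu, h⟩ := exists_marked_of_covers hc ha hj hz
    refine ⟨k, hk, hr, ?_⟩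
    rw [hp] at hlt h
    omega
  · rintro ⟨i, hi, hr, h⟩
    obtain ⟨hc, hlt⟩ := hi.covers hr
    have hlu := hi.lower_lt_upper hr
    have hz := conjWord_eq_of_marked hi
    refine ⟨conjWord a, ⟨hc, ?_⟩, (mem_RFPF_iff _ _).2 ⟨rfl, (reduced_iff a).1 hr⟩⟩
    rcases h with h | h
    · exact ⟨lowerLine (a, i), by rwa [h] at hlu, by rw [hz, h]⟩
    · refine ⟨y (lowerLine (a, i)), by rwa [h, hq] at hlt, ?_⟩
      rw [hz, ← hy.conj_swap_apply, h, hq]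

lemma finite_iUnion_PsiPlus (hy : IsFPF y) (hp : y p = q) :
    (⋃ z ∈ PsiPlus y q, RFPF z).Finite := by
  rw [iUnion_PsiPlus hy hp]
  -- A word is recovered from the unmarked letters, the marked position and the lower line: the
  -- suffix product applied to that line is the marked letter.
  refine (((finite_RFPF y).prod ((Set.finite_Iic (lenFPF y)).prod
    (Set.toFinite {p, q}))).image fun c : List ℤ × ℕ × ℤ =>
      c.1.take c.2.1 ++ wordProd (c.1.drop c.2.1) c.2.2 :: c.1.drop c.2.1).subset ?_
  rintro a ⟨i, hi, -, h⟩
  obtain ⟨A, x, S, rfl, rfl⟩ := exists_eq_append_cons hi.1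
  have hm := hi.2
  simp only [eraseIdx_append_cons] at hm
  refine ⟨(A ++ S, A.length, lowerLine (A ++ x :: S, A.length)), ⟨hm, ?_, h⟩, ?_⟩
  · rw [Set.mem_Iic, ← ((mem_RFPF_iff _ _).1 hm).2]
    simp
  · simp

lemma finite_of_finite_iUnion_RFPF {Z : Set (Perm ℤ)} (hZ : Z ⊆ FZ)
    (h : (⋃ z ∈ Z, RFPF z).Finite) : Z.Finite := by
  refine (h.image conjWord).subset fun z hz => ?_
  obtain ⟨a, ha⟩ := exists_word_length_eq_lenFPF (hZ hz)
  exact ⟨a, Set.mem_biUnion hz ((mem_RFPF_iff _ _).2 ha), ha.1⟩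

lemma ncard_iUnion_RFPF {Z : Set (Perm ℤ)} (hZ : Z.Finite) :
    (⋃ z ∈ Z, RFPF z).ncard = ∑ᶠ z ∈ Z, (RFPF z).ncard := by
  refine hZ.ncard_biUnion (fun z _ => finite_RFPF z) fun z _ z' _ hne => ?_
  refine Set.disjoint_left.2 fun a ha ha' => hne ?_
  rw [← ((mem_RFPF_iff _ _).1 ha).1, ((mem_RFPF_iff _ _).1 ha').1]

end FPFLittle

theorem theorem4 (y : Equiv.Perm ℤ) (hy : y ∈ FPFLittle.FZ) (p q : ℤ)
    (hpq : (p, q) ∈ FPFLittle.Cyc y) :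
    -- the operator, the Little bump and the Little map are well defined
    (∀ m : List ℤ × ℕ, FPFLittle.Marked y m → ¬ FPFLittle.Reduced m.1 →
      ¬ FPFLittle.SemiReduced m → ∃! j : ℕ, j ≠ m.2 ∧ FPFLittle.Marked y (m.1, j)) ∧
    (∀ m : List ℤ × ℕ, FPFLittle.Marked y m →
      ∃ N : ℕ, 0 < N ∧ FPFLittle.Reduced ((FPFLittle.down y)^[N] m).1) ∧
    (∀ z : Equiv.Perm ℤ, FPFLittle.Covers y z → ∀ a ∈ FPFLittle.RFPF z,
      ∃! i : ℕ, FPFLittle.Marked y (a, i)) ∧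
    -- the bijection
    Set.BijOn (FPFLittle.littleMap y)
      (⋃ z ∈ FPFLittle.PsiPlus y q, FPFLittle.RFPF z)
      (⋃ z ∈ FPFLittle.PsiMinus y p, FPFLittle.RFPF z) ∧
    -- the identity of cardinalities, all of them finite
    (FPFLittle.PsiPlus y q).Finite ∧ (FPFLittle.PsiMinus y p).Finite ∧
    (∀ z ∈ FPFLittle.PsiPlus y q ∪ FPFLittle.PsiMinus y p, (FPFLittle.RFPF z).Finite) ∧
    ∑ᶠ z ∈ FPFLittle.PsiPlus y q, (FPFLittle.RFPF z).ncard =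
      ∑ᶠ z ∈ FPFLittle.PsiMinus y p, (FPFLittle.RFPF z).ncard := by
  open FPFLittle in
  have hF := isFPF_of_mem_FZ hy
  have hp : y p = q := hpq.2
  have hq : y q = p := by rw [← hp, hF.1]
  have hbij : Set.BijOn (littleMap y) (⋃ z ∈ PsiPlus y q, RFPF z)
      (⋃ z ∈ PsiMinus y p, RFPF z) := by
    rw [iUnion_PsiPlus hF hp, iUnion_PsiMinus hF hp]
    refine littleMap_bijOn (K := fun l => l = p ∨ l = q) ?_
    rintro l (rfl | rfl)
    · exact Or.inr hp
    · exact Or.inl hq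
  have hfin := finite_iUnion_PsiPlus hF hp
  have hplus := finite_of_finite_iUnion_RFPF (fun z hz => hz.1.2.1) hfin
  -- Finiteness on this side is transported through the bijection.
  have hminus : (PsiMinus y p).Finite :=
    finite_of_finite_iUnion_RFPF (fun z hz => hz.1.2.1) (hbij.image_eq ▸ hfin.image _)
  exact ⟨fun m => existsUnique_marked, fun m => exists_reduced_down,
    fun z hz a => existsUnique_marked_of_covers hz, hbij, hplus, hminus,
    fun z _ => finite_RFPF z, by
      rw [← ncard_iUnion_RFPF hplus, ← ncard_iUnion_RFPF hminus, hbij.ncard_eq]⟩
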